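/- **Setting.** Let $p\neq d$ be odd primes, let $K/\mathbb{Q}_p$ be a finite unramified extension of degree $m$, so that its residue field is $\mathbb{F}_q$ with $q=p^m$, and let $f(x)=(x+p)^d-p\in K[x]$. For $n\ge 0$ let $f^n$ be the $n$-th iterate of $f$ and let $V_n=f^{-n}(0)=\{x\in K^{\mathrm{sep}} : f^n(x)=0\}$. Join $b\in V_{n+1}$ to $c\in V_n$ by an edge if $f(b)=c$. This gives a rooted tree $T$ with root $V_0=\{0\}$. Let $\mathcal{P}_d\subset\prod_n V_n$ be its space of infinite paths $(v_n)_{n\ge0}$ from the root, with the topology induced by the product of the discrete topologies. Let $\rho:\mathrm{Gal}(K^{\mathrm{sep}}/K)\to\mathrm{Aut}(T)$ be the arboreal representation, given by the action of the Galois group on the $V_n$, and let $H_\infty$ be its image. Let $BS(1,q)=\langle\tau,\sigma\mid\sigma\tau\sigma^{-1}=\tau^q\rangle$. For a descending chain $G=G_0\supseteq G_1\supseteq\cdots$ of finite index subgroups of a group $G$ and $0\le m\le n$, put $C^m_n=\bigcap_{g\in G_m}gG_ng^{-1}$ and let $\mathcal{D}^m=\varprojlim_{n\ge m}G_n/C^m_n$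 (the $m$-th discriminant group), a topological group as an inverse limit of discrete groups. For $m\le k$, the inclusions $C^m_n\subseteq C^k_n$ ($n\geq k$) induce a homomorphism $\mathcal{D}^m\to\mathcal{D}^k$. If the $G_n$ are the stabilizers of the vertices $v_n$ of a path in $T$ under an action of $G$ on $T$ that is transitive on every $V_n$, then $\{G_n\}$ is called the group chain associated to the action and the path $(v_n)$, and the action is called stable if the maps $\mathcal{D}^n\to\mathcal{D}^{n+1}$ are isomorphisms for all large $n$. **Theorem.** For every $n\ge0$ the set $V_n$ has exactly $d^n$ elements. There are a sequence of positive integers $(c_n)_{n\ge0}$ and a non-decreasing unbounded sequence of integers $(s_n)_{n\ge0}$, where $s_n$ is the order of $q$ in $(\mathbb{Z}/d^n\mathbb{Z})^\times$, and a homomorphism $\Phi:BS(1,q)\to\mathrm{Aut}(T)$ such that the following hold. 1. The action $\Phi$ is transitive on every $V_n$. The Ellis group of the induced action on $\mathcal{P}_d$, that is, the closure of $\Phi(BS(1,q))$ in the space of maps $\mathcal{P}_d\to\mathcal{P}_d$ with the topology of pointwise convergence, equals $H_\infty$ (regarded as a group of maps $\mathcal{P}_d\to\mathcal{P}_d$).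 2. For every $n\ge 0$, $$\mathrm{Gal}(K(f^{-n}(0))/K)\;\cong\; H_n=\langle\tau,\sigma\mid\sigma\tau\sigma^{-1}=\tau^q,\ \tau^{c_nd^n}=1,\ \sigma^{s_n}=1\rangle,$$ by an isomorphism under which the action of the Galois group on $V_n$ is induced by $\Phi$. The kernel of the natural map $BS(1,q)\to H_n$ is the subgroup $C_n=\langle\tau^{c_nd^n},\sigma^{s_n}\rangle$ of $BS(1,q)$, so $H_n=BS(1,q)/C_n$. 3. There is a path $\mathbf{v}=(v_n)\in\mathcal{P}_d$ such that, for every $n\ge0$, the stabilizer of $v_n$ in $BS(1,q)$ is $G_n=\langle\tau^{c_nd^n},\sigma\rangle$. In particular, $G_0=BS(1,q)$ and the $G_n$ form a descending chain of finite index subgroups. The maximal normal subgroup $\bigcap_{g\in BS(1,q)} gG_ng^{-1}$ of $G_n$ is $C_n$. 4. For the chain $\{G_n\}$, every discriminant group $\mathcal{D}^n$, $n\ge0$, is a Cantor group: a topological group whose space is non-empty, compact, totally disconnected, metrizable and without isolated points (in particular infinite and profinite). For all $n\le k$ the homomorphism $\mathcal{D}^n\to\mathcal{D}^k$ is an isomorphism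 of topological groups. In particular, the action is stable. -/

import Mathlib

open Polynomial

noncomputable section

namespace Arboreal

/-! ### The tree of preimages and the arboreal representation -/

section Tree

variable {K : Type*} [Field K]

/-- The solutions of `f^n(x) = α` in a separable closure of `K`, `f^n` the `n`-fold iterate. -/
def levelSet (f : K[X]) (α : K) (n : ℕ) : Set (SeparableClosure K) :=
  {x | (fun y : SeparableClosure K => aeval y f)^[n] x = algebraMap K (SeparableClosure K) α}

/-- The `n`-th level `V_n` of the tree, with the discrete topology. -/
def Level (f : K[X]) (α : K) (n : ℕ) : Type _ := levelSet f α n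

instance (f : K[X]) (α : K) (n : ℕ) : TopologicalSpace (Level f α n) := ⊥

/-- The element of the separable closure that a vertex is. -/
def Level.val {f : K[X]} {α : K} {n : ℕ} (x : Level f α n) : SeparableClosure K := Subtype.val x

/-- The edges of the tree: `b` in `V_{n+1}` is joined to `f(b)` in `V_n`. -/
def parent {f : K[X]} {α : K} {n : ℕ} (b : Level f α (n + 1)) : Level f α n :=
  ⟨aeval b.val f, by
    have h := b.2
    simp only [levelSet, Set.mem_ofPred_eq, Function.iterate_succ_apply] at h
    exact h⟩

/-- The space of infinite paths in the tree starting at the root,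
a subspace of the product of the discrete sets `V_n`. -/
def Path (f : K[X]) (α : K) : Type _ :=
  {v : ∀ n, Level f α n // ∀ n, parent (v (n + 1)) = v n}

instance (f : K[X]) (α : K) : TopologicalSpace (Path f α) :=
  inferInstanceAs (TopologicalSpace {v : ∀ n, Level f α n // ∀ n, parent (v (n + 1)) = v n})

/-- The `n`-th vertex of a path. -/
def Path.vertex {f : K[X]} {α : K} (v : Path f α) (n : ℕ) : Level f α n := v.1 n

/-- The automorphism group of the rooted tree: permutations of every level that preserve edges. -/
def TreeAut (f : K[X]) (α : K) : Subgroup (∀ n, Equiv.Perm (Level f α n)) where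
  carrier := {a | ∀ n (b : Level f α (n + 1)), parent (a (n + 1) b) = a n (parent b)}
  one_mem' := fun _ _ => rfl
  mul_mem' := by
    intro a b ha hb n x
    simp only [Pi.mul_apply, Equiv.Perm.mul_apply]
    rw [ha, hb]
  inv_mem' := by
    intro a ha n x
    simp only [Pi.inv_apply]
    rw [Equiv.Perm.eq_inv_iff_eq, ← ha]
    exact congrArg parent ((a (n + 1)).apply_symm_apply x)

/-- The action of a tree automorphism on the vertices of level `n`. -/
def actLevel {f : K[X]} {α : K} (a : TreeAut f α) (n : ℕ) (x : Level f α n) :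
    Level f α n := a.1 n x

/-- The action of a tree automorphism on the space of paths. -/
def actPath {f : K[X]} {α : K} (a : TreeAut f α) (v : Path f α) : Path f α :=
  ⟨fun n => actLevel a n (v.vertex n), fun n => by
    have h := a.2 n (v.1 (n + 1))
    rw [v.2 n] at h
    exact h⟩

theorem iterate_galois (f : K[X]) (g : SeparableClosure K ≃ₐ[K] SeparableClosure K) (n : ℕ)
    (x : SeparableClosure K) :
    (fun y : SeparableClosure K => aeval y f)^[n] (g x) =
      g ((fun y : SeparableClosure K => aeval y f)^[n] x) := by
  induction n generalizing x with
  | zero => rfl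
  | succ n ih =>
    simp only [Function.iterate_succ_apply]
    rw [← ih, Polynomial.aeval_algHom_apply]

theorem galois_mem_levelSet {f : K[X]} {α : K} {n : ℕ}
    (g : SeparableClosure K ≃ₐ[K] SeparableClosure K) {x : SeparableClosure K}
    (hx : x ∈ levelSet f α n) : g x ∈ levelSet f α n := by
  simp only [levelSet, Set.mem_ofPred_eq] at hx ⊢
  rw [iterate_galois, hx, AlgEquiv.commutes]

/-- The permutation of `V_n` by an element of the absolute Galois group. -/
def galoisPerm (f : K[X]) (α : K) (n : ℕ) :
    (SeparableClosure K ≃ₐ[K] SeparableClosure K) →* Equiv.Perm (Level f α n) where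
  toFun g :=
    { toFun := fun x => ⟨g x.1, galois_mem_levelSet g x.2⟩
      invFun := fun x => ⟨g⁻¹ x.1, galois_mem_levelSet g⁻¹ x.2⟩
      left_inv := fun x => Subtype.ext (AlgEquiv.symm_apply_apply g x.1)
      right_inv := fun x => Subtype.ext (AlgEquiv.apply_symm_apply g x.1) }
  map_one' := rfl
  map_mul' _ _ := rfl

/-- The arboreal representation of the absolute Galois group of `K` on the tree. -/
def arborealRep (f : K[X]) (α : K) :
    (SeparableClosure K ≃ₐ[K] SeparableClosure K) →* TreeAut f α :=
  (MonoidHom.pi (galoisPerm f α)).codRestrict (TreeAut f α) (by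
    intro g n b
    apply Subtype.ext
    exact Polynomial.aeval_algHom_apply (g : SeparableClosure K →ₐ[K] SeparableClosure K) b.1 f)

/-- The image of the arboreal representation, as a set of self-maps of the path space. -/
def arborealImage (f : K[X]) (α : K) : Set (Path f α → Path f α) :=
  Set.range fun g => actPath (arborealRep f α g)

/-- The Ellis (enveloping) semigroup of an action of a discrete group through tree automorphisms:
the closure, in the topology of pointwise convergence, of the self-maps of the path space
given by the group elements. -/
def ellisSemigroup {G : Type*} [Group G] {f : K[X]} {α : K} (Φ : G →* TreeAut f α) :
    Set (Path f α → Path f α) :=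
  closure (Set.range fun g => actPath (Φ g))

/-- The isotropy subgroup of a vertex. -/
def vertexStabilizer {G : Type*} [Group G] {f : K[X]} {α : K} (Φ : G →* TreeAut f α) {n : ℕ}
    (x : Level f α n) : Subgroup G where
  carrier := {g | actLevel (Φ g) n x = x}
  one_mem' := by
    change actLevel (Φ 1) n x = x
    rw [map_one]
    rfl
  mul_mem' := by
    intro a b ha hb
    change actLevel (Φ (a * b)) n x = x
    change actLevel (Φ a) n x = x at ha
    change actLevel (Φ b) n x = x at hb
    rw [map_mul]
    change actLevel (Φ a) n (actLevel (Φ b) n x) = x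
    rw [hb, ha]
  inv_mem' := by
    intro a ha
    change actLevel (Φ a⁻¹) n x = x
    rw [map_inv]
    change ((Φ a).1 n)⁻¹ x = x
    rw [Equiv.Perm.inv_eq_iff_eq]
    exact ha.symm

/-- The extension `K_n = K(f^{-n}(α))`. -/
abbrev levelField (f : K[X]) (α : K) (n : ℕ) : IntermediateField K (SeparableClosure K) :=
  IntermediateField.adjoin K (levelSet f α n)

/-- A vertex of level `n` as an element of `K(f^{-n}(α))`. -/
def Level.toLevelField {f : K[X]} {α : K} {n : ℕ} (x : Level f α n) : levelField f α n :=
  ⟨x.val, IntermediateField.subset_adjoin K _ x.2⟩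

end Tree

/-! ### Group chains and discriminant groups -/

/-- A descending chain `G = G_0 ⊇ G_1 ⊇ ⋯` of subgroups of finite index. -/
structure GroupChain (G : Type*) [Group G] where
  grp : ℕ → Subgroup G
  grp_zero : grp 0 = ⊤
  antitone : Antitone grp
  finiteIndex : ∀ n, (grp n).FiniteIndex

namespace GroupChain

variable {G : Type*} [Group G] (S : GroupChain G)

/-- `C^m_n`, the intersection of all `g G_n g⁻¹` with `g` in `G_m`. -/
def core (m n : ℕ) : Subgroup G :=
  ⨅ g : S.grp m, (S.grp n).map (MulAut.conj (g : G)).toMonoidHom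

theorem mem_core {m n : ℕ} {x : G} :
    x ∈ S.core m n ↔ ∀ g ∈ S.grp m, g⁻¹ * x * g ∈ S.grp n := by
  simp only [core, Subgroup.mem_iInf, Subtype.forall]
  refine forall₂_congr fun g _ => ?_
  constructor
  · rintro ⟨y, hy, rfl⟩
    simpa [mul_assoc] using hy
  · intro h
    exact ⟨_, h, by simp [mul_assoc]⟩

theorem core_mono {m k n : ℕ} (h : m ≤ k) : S.core m n ≤ S.core k n := by
  intro x hx
  rw [mem_core] at hx ⊢
  exact fun g hg => hx g (S.antitone h hg)

theorem core_anti {m n n' : ℕ} (h : n ≤ n') : S.core m n' ≤ S.core m n := by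
  intro x hx
  rw [mem_core] at hx ⊢
  exact fun g hg => S.antitone h (hx g hg)

instance core_normal (m : ℕ) (n : Set.Ici m) :
    ((S.core m n).subgroupOf (S.grp n)).Normal where
  conj_mem := by
    intro x hx a
    rw [Subgroup.mem_subgroupOf, mem_core] at hx ⊢
    intro g hg
    have h := hx ((a : G)⁻¹ * g) (mul_mem (inv_mem (S.antitone n.2 a.2)) hg)
    simpa [mul_assoc] using h

/-- The finite group `G_n / C^m_n`, `n ≥ m`, with the discrete topology. -/
def Quot (m : ℕ) (n : Set.Ici m) : Type _ := S.grp n ⧸ (S.core m n).subgroupOf (S.grp n)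

instance (m : ℕ) (n : Set.Ici m) : Group (S.Quot m n) :=
  inferInstanceAs (Group (S.grp n ⧸ (S.core m n).subgroupOf (S.grp n)))

instance (m : ℕ) (n : Set.Ici m) : TopologicalSpace (S.Quot m n) := ⊥

/-- The map `G_{n'} / C^m_{n'} → G_n / C^m_n` induced by inclusion. -/
def bond (m : ℕ) {n n' : Set.Ici m} (h : n ≤ n') : S.Quot m n' →* S.Quot m n :=
  QuotientGroup.map _ _ (Subgroup.inclusion (S.antitone h)) (by
    intro x hx
    rw [Subgroup.mem_comap, Subgroup.mem_subgroupOf]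
    rw [Subgroup.mem_subgroupOf] at hx
    exact S.core_anti h hx)

/-- The discriminant group `D^m`, the inverse limit of the groups `G_n / C^m_n` over `n ≥ m`. Its
topology is induced by the product topology. -/
def Disc (m : ℕ) : Subgroup (∀ n : Set.Ici m, S.Quot m n) where
  carrier := {x | ∀ (n n' : Set.Ici m) (h : n ≤ n'), S.bond m h (x n') = x n}
  one_mem' := fun _ _ _ => map_one _
  mul_mem' := by
    intro x y hx hy n n' h
    simp only [Pi.mul_apply, map_mul]
    rw [hx n n' h, hy n n' h]
  inv_mem' := by
    intro x hx n n' h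
    simp only [Pi.inv_apply, map_inv]
    rw [hx n n' h]

/-- The map `G_n / C^m_n → G_n / C^k_n` induced by the inclusion of `C^m_n` in `C^k_n`, for
`m ≤ k ≤ n`. -/
def quotMap {m k : ℕ} (h : m ≤ k) (n : Set.Ici k) :
    S.Quot m ⟨n, le_trans h n.2⟩ →* S.Quot k n :=
  QuotientGroup.map _ _ (MonoidHom.id _) (by
    intro x hx
    rw [Subgroup.mem_comap, Subgroup.mem_subgroupOf]
    rw [Subgroup.mem_subgroupOf] at hx
    exact S.core_mono h hx)

theorem quotMap_bond {m k : ℕ} (h : m ≤ k) {n n' : Set.Ici k} (hn : n ≤ n')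
    (x : S.Quot m ⟨n', le_trans h n'.2⟩) :
    S.bond k hn (S.quotMap h n' x) =
      S.quotMap h n (S.bond m (n := ⟨n, le_trans h n.2⟩) (n' := ⟨n', le_trans h n'.2⟩) hn x) := by
  induction x using QuotientGroup.induction_on
  rfl

/-- The natural homomorphism `D^m → D^k`, `m ≤ k`, of discriminant groups. -/
def discMap {m k : ℕ} (h : m ≤ k) : S.Disc m →* S.Disc k where
  toFun x := ⟨fun n => S.quotMap h n (x.1 ⟨n, le_trans h n.2⟩), fun n n' hn => by
    rw [quotMap_bond, x.2 ⟨n, le_trans h n.2⟩ ⟨n', le_trans h n'.2⟩ hn]⟩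
  map_one' := by
    apply Subtype.ext
    funext n
    exact map_one _
  map_mul' x y := by
    apply Subtype.ext
    funext n
    exact map_mul _ _ _

/-- Stability of the asymptotic discriminant: the maps `D^n → D^{n+1}` are isomorphisms from some
index on. -/
def IsStable : Prop :=
  ∃ m : ℕ, ∀ n, m ≤ n → Function.Bijective (S.discMap (Nat.le_succ n))

end GroupChain

/-- A Cantor set: a non-empty compact totally disconnected metrizable space without isolated
points. -/
def IsCantorSet (X : Type*) [TopologicalSpace X] : Prop :=
  Nonempty X ∧ CompactSpace X ∧ TotallyDisconnectedSpace X ∧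
    TopologicalSpace.MetrizableSpace X ∧ PerfectSpace X

/-- A Cantor group: a (profinite) topological group whose underlying space is a Cantor set. -/
def IsCantorGroup (D : Type*) [Group D] [TopologicalSpace D] : Prop :=
  IsTopologicalGroup D ∧ IsCantorSet D

/-! ### Baumslag-Solitar groups -/

/-- The names of the two generators. -/
inductive BSGen
  | tau
  | sigma

/-- The relation `σ τ σ⁻¹ = τ ^ q`. -/
def bsRels (q : ℕ) : Set (FreeGroup BSGen) :=
  {FreeGroup.of .sigma * FreeGroup.of .tau * (FreeGroup.of .sigma)⁻¹ * (FreeGroup.of .tau ^ q)⁻¹}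

/-- The relations `σ τ σ⁻¹ = τ ^ q`, `τ ^ a = 1`, `σ ^ b = 1`. -/
def metacyclicRels (q a b : ℕ) : Set (FreeGroup BSGen) :=
  bsRels q ∪ {FreeGroup.of .tau ^ a, FreeGroup.of .sigma ^ b}

/-- The Baumslag-Solitar group `BS(1,q) = ⟨τ, σ | σ τ σ⁻¹ = τ ^ q⟩`. -/
abbrev BS (q : ℕ) : Type := PresentedGroup (bsRels q)

/-- The group `⟨τ, σ | σ τ σ⁻¹ = τ ^ q, τ ^ a = 1, σ ^ b = 1⟩`. -/
abbrev Metacyclic (q a b : ℕ) : Type := PresentedGroup (metacyclicRels q a b)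

/-- The generator `τ` of `BS(1,q)`. -/
def BS.tau (q : ℕ) : BS q := PresentedGroup.of .tau

/-- The generator `σ` of `BS(1,q)`. -/
def BS.sigma (q : ℕ) : BS q := PresentedGroup.of .sigma

/-- The quotient map sending `τ` to `τ` and `σ` to `σ`. -/
def BS.toMetacyclic (q a b : ℕ) : BS q →* Metacyclic q a b :=
  PresentedGroup.map (MonoidHom.id _) fun _ hr => Or.inl hr

/-! ### Unramified extensions of the `p`-adic numbers -/

/-- `K` is an unramified extension of `ℚ_p` of degree `m`: the residue field of the ring of
integers of `K` (the integral closure of `ℤ_p`, which is a local ring) has `p ^ m` elements, where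
`m = [K : ℚ_p]`. -/
def IsUnramifiedOfDegree (p : ℕ) [Fact p.Prime] (K : Type*) [Field K] [Algebra ℚ_[p] K]
    [Algebra ℤ_[p] K] (m : ℕ) : Prop :=
  Module.finrank ℚ_[p] K = m ∧
    ∃ M : Ideal (integralClosure ℤ_[p] K),
      M.IsMaximal ∧ Nat.card (integralClosure ℤ_[p] K ⧸ M) = p ^ m

end Arboreal

end

/-!
The translation by `p` conjugates `f = (X + p) ^ d - p` to `X ^ d`, so the level `V_n` consists of the
elements `ζ ^ i * π - p` with `i ∈ ℤ/dⁿ`, where `ζ = ζ_n` is a primitive root of unity of order `dⁿ`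
and `π = π_n` is a `dⁿ`-th root of `p`. With compatible choices of the `ζ_n` and `π_n`
(`RootSystem`), the edges of the tree become the reductions `ℤ/dⁿ⁺¹ → ℤ/dⁿ` of the labels, and a
Galois automorphism `g` with `g ζ = ζ ^ u`, `g π = ζ ^ a * π` acts on the labels by
`i ↦ u * i + a`. The group `BS(1,q)` acts on the labels by `τ : i ↦ i + 1` and `σ : i ↦ q * i`. The
theorem holds with `c_n = 1`, because two facts about these affine actions are true.

First, on each level both groups induce the same permutations (`RootSystem.range_levelPerm`), that
is, all `i ↦ u * i + a` with `u` a power of `q`. This is the arithmetic content: an automorphism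
raises `ζ` to a power of `q` (`exists_galois_eq_pow`), the power `q` occurs
(`exists_galois_frobenius`), and some automorphism fixes `ζ` and maps `π` to `ζ * π`
(`exists_galois_tame`).
All three are deduced from a Galois invariant extension of the `p`-adic valuation, the spectral norm,
together with the fact that `p` generates the maximal ideal of the ring of integers of `K`. For the
third, a trace argument replaces ramification theory: if `y ^ d = p` and `y` were fixed by the
stabilizer of `ζ`, then the traces of the `y * ζ ^ j` would be divisible by `p`, and so would `y`,
which is a combination of them with coefficients that are units at `p`.
The description of the Galois group follows, and so does that of the Ellis group, since the image of
the arboreal representation is compact and both groups have the same approximations on finite levels.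

Second, every element of `BS(1,q)` has the form `σ⁻ⁱ τᵏ σʲ` (`BS.exists_normalForm`), and it acts on
labels by `q ^ i * y = q ^ j * x + k`. Stabilizers and kernels are read off from this, and so is
`C^m_n`, which consists of the elements with `dⁿ ∣ k` and `q ^ i = q ^ j` modulo `d ^ (n - m)`
(`normalForm_mem_affineChain_core`). The second condition depends only on `n - m`, so a shift of the
indices inverts the maps of discriminant groups (`GroupChain.isHomeomorph_discMap_of_core_le`). The
discriminant groups have no isolated points because the order of `q` modulo `dⁿ` is unbounded.
-/

namespace Arboreal

/-! ### Baumslag-Solitar groups acting by affine maps -/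

namespace BS

theorem sigma_mul_tau (q : ℕ) : sigma q * tau q = tau q ^ q * sigma q := by
  have h : sigma q * tau q * (sigma q)⁻¹ * (tau q ^ q)⁻¹ = 1 :=
    PresentedGroup.one_of_mem (rels := bsRels q) (Set.mem_singleton _)
  rw [mul_inv_eq_one, mul_inv_eq_iff_eq_mul] at h
  exact h

theorem sigma_mul_tau_zpow (q : ℕ) (k : ℤ) :
    sigma q * tau q ^ k = tau q ^ (q * k : ℤ) * sigma q := by
  have h : SemiconjBy (sigma q) (tau q) (tau q ^ q) := sigma_mul_tau q
  have := h.zpow_right k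
  rw [← zpow_natCast, ← zpow_mul] at this
  exact this

theorem sigma_pow_mul_tau_zpow (q i : ℕ) (k : ℤ) :
    sigma q ^ i * tau q ^ k = tau q ^ ((q : ℤ) ^ i * k) * sigma q ^ i := by
  induction i generalizing k with
  | zero => simp
  | succ i ih =>
    rw [pow_succ, mul_assoc, sigma_mul_tau_zpow, ← mul_assoc, ih, mul_assoc, ← pow_succ]
    ring_nf

theorem closure_tau_sigma (q : ℕ) : Subgroup.closure {tau q, sigma q} = ⊤ := by
  rw [← PresentedGroup.closure_range_of (bsRels q)]
  congr 1
  ext x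
  constructor
  · rintro (rfl | rfl)
    exacts [⟨_, rfl⟩, ⟨_, rfl⟩]
  · rintro ⟨(_ | _), rfl⟩
    exacts [Or.inl rfl, Or.inr rfl]

/-- The normal form exists because conjugation by `σ` maps `⟨τ⟩` into itself. -/
theorem exists_normalForm (q : ℕ) (g : BS q) :
    ∃ (i j : ℕ) (k : ℤ), g = (sigma q ^ i)⁻¹ * tau q ^ k * sigma q ^ j := by
  have htau : ∀ (l k : ℤ) (i j : ℕ), tau q ^ l * ((sigma q ^ i)⁻¹ * tau q ^ k * sigma q ^ j) =
      (sigma q ^ i)⁻¹ * tau q ^ ((q : ℤ) ^ i * l + k) * sigma q ^ j := by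
    intro l k i j
    rw [zpow_add, eq_comm, mul_assoc, mul_assoc, inv_mul_eq_iff_eq_mul, ← mul_assoc, ← mul_assoc,
      sigma_pow_mul_tau_zpow]
    simp [mul_assoc]
  have hg : g ∈ Subgroup.closure {tau q, sigma q} := closure_tau_sigma q ▸ Subgroup.mem_top g
  induction hg using Subgroup.closure_induction_left with
  | one => exact ⟨0, 0, 0, by simp⟩
  | mul_left x hx y hy ih =>
    obtain ⟨i, j, k, rfl⟩ := ih
    rcases hx with rfl | rfl
    · exact ⟨i, j, _, by rw [← htau 1 k i j, zpow_one]⟩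
    · rcases i with _ | i
      · refine ⟨0, j + 1, q * k, ?_⟩
        simp only [pow_zero, inv_one, one_mul]
        rw [← mul_assoc, sigma_mul_tau_zpow, mul_assoc, pow_succ']
      · refine ⟨i, j, k, ?_⟩
        rw [pow_succ]
        group
  | inv_mul_cancel x hx y hy ih =>
    obtain ⟨i, j, k, rfl⟩ := ih
    rcases hx with rfl | rfl
    · exact ⟨i, j, _, by rw [← htau (-1) k i j, zpow_neg_one]⟩
    · exact ⟨i + 1, j, k, by rw [pow_succ]; group⟩

end BS

section Affine

variable {q N : ℕ}

theorem addRight_one_zpow_apply (k : ℤ) (x : ZMod N) :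
    ((Equiv.addRight 1 : Equiv.Perm (ZMod N)) ^ k) x = x + k := by
  induction k generalizing x with
  | zero => simp
  | succ k ih => rw [zpow_add_one, Equiv.Perm.mul_apply, ih]; simp; ring
  | pred k ih =>
    rw [zpow_sub_one, Equiv.Perm.mul_apply, ih, Equiv.Perm.inv_def, Equiv.addRight_symm]
    simp; ring

/-- The action of `BS(1,q)` on `ℤ/N` by affine maps, `τ` acting as `x ↦ x + 1` and `σ` as
`x ↦ q x`. -/
noncomputable def affineAction (h : q.Coprime N) : BS q →* Equiv.Perm (ZMod N) :=
  PresentedGroup.toGroup (rels := bsRels q)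
    (f := fun | .tau => Equiv.addRight 1 | .sigma => (ZMod.unitOfCoprime q h).mulLeft) (by
      rintro r rfl
      simp only [map_mul, map_inv, map_pow, FreeGroup.lift_apply_of]
      rw [mul_inv_eq_one, mul_inv_eq_iff_eq_mul]
      ext x
      simp [← zpow_natCast, mul_add])

variable (h : q.Coprime N)

theorem affineAction_tau (x : ZMod N) : affineAction h (BS.tau q) x = x + 1 := by
  simp [affineAction, BS.tau]

theorem affineAction_sigma (x : ZMod N) : affineAction h (BS.sigma q) x = q * x := by
  simp [affineAction, BS.sigma]

theorem affineAction_tau_zpow (k : ℤ) (x : ZMod N) :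
    affineAction h (BS.tau q ^ k) x = x + k := by
  have h1 : affineAction h (BS.tau q) = Equiv.addRight 1 := by
    ext x; simp [affineAction_tau]
  rw [map_zpow, h1, addRight_one_zpow_apply]

theorem affineAction_sigma_pow (j : ℕ) (x : ZMod N) :
    affineAction h (BS.sigma q ^ j) x = q ^ j * x := by
  induction j with
  | zero => simp
  | succ j ih => rw [pow_succ', map_mul, Equiv.Perm.mul_apply, ih, affineAction_sigma]; ring

/-- The action of an element in normal form. -/
theorem affineAction_normalForm (i j : ℕ) (k : ℤ) (x y : ZMod N) :
    affineAction h ((BS.sigma q ^ i)⁻¹ * BS.tau q ^ k * BS.sigma q ^ j) x = y ↔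
      (q : ZMod N) ^ j * x + k = q ^ i * y := by
  rw [mul_assoc, map_mul, map_inv, Equiv.Perm.mul_apply, Equiv.Perm.inv_eq_iff_eq, map_mul,
    Equiv.Perm.mul_apply, affineAction_sigma_pow, affineAction_tau_zpow, affineAction_sigma_pow]

theorem isUnit_natCast_pow (h : q.Coprime N) (i : ℕ) : IsUnit ((q : ZMod N) ^ i) :=
  ((ZMod.isUnit_iff_coprime q N).2 h).pow i

theorem affineAction_castHom {M : ℕ} (h' : q.Coprime M) (hMN : M ∣ N) (g : BS q) (x : ZMod N) :
    ZMod.castHom hMN (ZMod M) (affineAction h g x) =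
      affineAction h' g (ZMod.castHom hMN (ZMod M) x) := by
  obtain ⟨i, j, k, rfl⟩ := BS.exists_normalForm q g
  have := congrArg (ZMod.castHom hMN (ZMod M)) ((affineAction_normalForm h i j k x _).1 rfl)
  refine ((affineAction_normalForm h' i j k _ _).2 ?_).symm
  simpa only [map_add, map_mul, map_pow, map_natCast, map_intCast] using this

theorem affineAction_transitive (x y : ZMod N) : ∃ g, affineAction h g x = y := by
  obtain ⟨a, rfl⟩ := ZMod.intCast_surjective x
  obtain ⟨b, rfl⟩ := ZMod.intCast_surjective y
  exact ⟨BS.tau q ^ (b - a), by rw [affineAction_tau_zpow]; push_cast; ring⟩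

/-- The subgroup `⟨τ ^ n, σ ^ t⟩` of `BS(1,q)` contains the conjugates of `τ ^ n` by all negative
powers of `σ`, not only by those with exponents divisible by `t`. -/
theorem mem_closure_tau_sigma_pow (n : ℕ) (t : ℕ) (ht : 0 < t) {i j : ℕ} {k : ℤ}
    (hk : (n : ℤ) ∣ k) (hij : i ≡ j [MOD t]) :
    (BS.sigma q ^ i)⁻¹ * BS.tau q ^ k * BS.sigma q ^ j ∈
      Subgroup.closure {BS.tau q ^ n, BS.sigma q ^ t} := by
  set C := Subgroup.closure {BS.tau q ^ n, BS.sigma q ^ t}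
  have hτ : BS.tau q ^ n ∈ C := Subgroup.subset_closure (Or.inl rfl)
  have hσ : BS.sigma q ^ t ∈ C := Subgroup.subset_closure (Or.inr rfl)
  -- The exponent of `σ⁻¹` may be enlarged to a multiple of `t`, at the cost of multiplying `k`
  -- by a power of `q`.
  obtain ⟨e, he⟩ : ∃ e, i + e = t * i := ⟨t * i - i, by
    have := Nat.le_mul_of_pos_left i ht; omega⟩
  have h1 : (BS.sigma q ^ i)⁻¹ * BS.tau q ^ k * BS.sigma q ^ j =
      (BS.sigma q ^ (t * i))⁻¹ * BS.tau q ^ ((q : ℤ) ^ e * k) * BS.sigma q ^ (j + e) := by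
    rw [← he, add_comm j e, pow_add _ e j, ← mul_assoc, mul_assoc _ (BS.tau q ^ _) (BS.sigma q ^ e),
      ← BS.sigma_pow_mul_tau_zpow, add_comm i e, pow_add]
    group
  have h2 : t ∣ j + e := by
    rw [← Nat.modEq_zero_iff_dvd]
    calc j + e ≡ i + e [MOD t] := (hij.add_right e).symm
      _ ≡ 0 [MOD t] := by rw [he, Nat.modEq_zero_iff_dvd]; exact dvd_mul_right _ _
  obtain ⟨r, hr⟩ := h2
  obtain ⟨l, rfl⟩ := hk
  rw [h1, hr, pow_mul, pow_mul]
  refine mul_mem (mul_mem (inv_mem (pow_mem hσ _)) ?_) (pow_mem hσ _)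
  rw [mul_left_comm, zpow_mul, zpow_natCast]
  exact zpow_mem hτ _

theorem affineAction_fix_zero_iff (i j : ℕ) (k : ℤ) :
    affineAction h ((BS.sigma q ^ i)⁻¹ * BS.tau q ^ k * BS.sigma q ^ j) 0 = 0 ↔ (N : ℤ) ∣ k := by
  rw [affineAction_normalForm, mul_zero, mul_zero, zero_add, ZMod.intCast_zmod_eq_zero_iff_dvd]

/-- The stabilizer of `0` in `BS(1,q)` is generated by `τ ^ N` and `σ`. -/
theorem affineAction_apply_zero_eq_zero_iff (g : BS q) :
    affineAction h g 0 = 0 ↔ g ∈ Subgroup.closure {BS.tau q ^ N, BS.sigma q} := by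
  constructor
  · obtain ⟨i, j, k, rfl⟩ := BS.exists_normalForm q g
    rw [affineAction_fix_zero_iff]
    intro hk
    simpa using mem_closure_tau_sigma_pow (q := q) N 1 one_pos hk (Nat.modEq_one : i ≡ j [MOD 1])
  · intro hg
    induction hg using Subgroup.closure_induction with
    | mem x hx =>
      rcases hx with rfl | rfl
      · rw [← zpow_natCast, affineAction_tau_zpow]; simp
      · rw [affineAction_sigma, mul_zero]
    | one => simp
    | mul x y _ _ hx hy => rw [map_mul, Equiv.Perm.mul_apply, hy, hx]
    | inv x _ hx => rw [map_inv, Equiv.Perm.inv_eq_iff_eq, hx]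

theorem orderOf_natCast_pos [NeZero N] (h : q.Coprime N) : 0 < orderOf (q : ZMod N) := by
  rw [← ZMod.coe_unitOfCoprime q h, orderOf_units]
  exact orderOf_pos _

theorem natCast_pow_eq_pow_iff [NeZero N] (h : q.Coprime N) (i j : ℕ) :
    (q : ZMod N) ^ i = q ^ j ↔ i ≡ j [MOD orderOf (q : ZMod N)] := by
  rw [← ZMod.coe_unitOfCoprime q h, orderOf_units, ← pow_eq_pow_iff_modEq, ← Units.val_pow_eq_pow_val,
    ← Units.val_pow_eq_pow_val, Units.val_inj]

/-- The kernel of the affine action is generated by `τ ^ N` and `σ ^ s`, with `s` the order of `q`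
modulo `N`. -/
theorem ker_affineAction [NeZero N] :
    (affineAction h).ker =
      Subgroup.closure {BS.tau q ^ N, BS.sigma q ^ orderOf (q : ZMod N)} := by
  apply le_antisymm
  · intro g hg
    obtain ⟨i, j, k, rfl⟩ := BS.exists_normalForm q g
    rw [MonoidHom.mem_ker] at hg
    have h0 := (affineAction_fix_zero_iff h i j k).1 (by rw [hg]; rfl)
    have h1 := (affineAction_normalForm h i j k 1 1).1 (by rw [hg]; rfl)
    rw [(ZMod.intCast_zmod_eq_zero_iff_dvd k N).2 h0, mul_one, mul_one, add_zero] at h1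
    exact mem_closure_tau_sigma_pow _ _ (orderOf_natCast_pos h) h0
      ((natCast_pow_eq_pow_iff h _ _).1 h1.symm)
  · rw [Subgroup.closure_le]
    rintro _ (rfl | rfl) <;> refine Equiv.ext fun x => ?_
    · rw [← zpow_natCast, affineAction_tau_zpow]; simp
    · rw [affineAction_sigma_pow, pow_orderOf_eq_one, one_mul]; rfl

/-- The affine action factors through the finite metacyclic quotient. -/
noncomputable def metacyclicAction :
    Metacyclic q N (orderOf (q : ZMod N)) →* Equiv.Perm (ZMod N) :=
  PresentedGroup.toGroup (rels := metacyclicRels q N (orderOf (q : ZMod N)))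
    (f := fun a => affineAction h (PresentedGroup.of a)) (by
      have hlift : ∀ r, FreeGroup.lift (fun a => affineAction h (PresentedGroup.of a)) r =
          affineAction h (PresentedGroup.mk (bsRels q) r) := fun r =>
        DFunLike.congr_fun (FreeGroup.ext_hom
          (f := FreeGroup.lift fun a => affineAction h (PresentedGroup.of a))
          (g := (affineAction h).comp (PresentedGroup.mk (bsRels q)))
          fun a => by simp [PresentedGroup.of]) r
      intro r hr
      rw [hlift]
      rcases hr with hr | rfl | rfl
      · rw [PresentedGroup.one_of_mem hr, map_one]
      · refine Equiv.ext fun x => ?_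
        change affineAction h (BS.tau q ^ N) x = x
        rw [← zpow_natCast, affineAction_tau_zpow]; simp
      · refine Equiv.ext fun x => ?_
        change affineAction h (BS.sigma q ^ _) x = x
        rw [affineAction_sigma_pow, pow_orderOf_eq_one, one_mul])

theorem metacyclicAction_toMetacyclic (g : BS q) :
    metacyclicAction h (BS.toMetacyclic q N _ g) = affineAction h g := by
  refine DFunLike.congr_fun (f := (metacyclicAction h).comp (BS.toMetacyclic q N _))
    (PresentedGroup.ext fun a => ?_) g
  have h1 : BS.toMetacyclic q N (orderOf (q : ZMod N)) (PresentedGroup.of a) =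
      PresentedGroup.of a := rfl
  rw [MonoidHom.comp_apply, h1, metacyclicAction, PresentedGroup.toGroup.of]

theorem BS.toMetacyclic_surjective (q a b : ℕ) : Function.Surjective (BS.toMetacyclic q a b) := by
  intro x
  obtain ⟨r, rfl⟩ := PresentedGroup.mk_surjective _ x
  exact ⟨PresentedGroup.mk _ r, rfl⟩

theorem BS.closure_le_ker_toMetacyclic (q a b : ℕ) :
    Subgroup.closure {BS.tau q ^ a, BS.sigma q ^ b} ≤ (BS.toMetacyclic q a b).ker := by
  rw [Subgroup.closure_le]
  rintro _ (rfl | rfl)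
  · exact PresentedGroup.one_of_mem (rels := metacyclicRels q a b) (Or.inr (Or.inl rfl))
  · exact PresentedGroup.one_of_mem (rels := metacyclicRels q a b) (Or.inr (Or.inr rfl))

theorem ker_toMetacyclic [NeZero N] (h : q.Coprime N) :
    (BS.toMetacyclic q N (orderOf (q : ZMod N))).ker =
      Subgroup.closure {BS.tau q ^ N, BS.sigma q ^ orderOf (q : ZMod N)} := by
  refine le_antisymm (fun g hg => ?_) (BS.closure_le_ker_toMetacyclic _ _ _)
  rw [← ker_affineAction h, MonoidHom.mem_ker, ← metacyclicAction_toMetacyclic,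
    MonoidHom.mem_ker.1 hg, map_one]

theorem metacyclicAction_injective [NeZero N] : Function.Injective (metacyclicAction h) := by
  rw [injective_iff_map_eq_one]
  intro x hx
  obtain ⟨g, rfl⟩ := BS.toMetacyclic_surjective _ _ _ x
  rw [metacyclicAction_toMetacyclic, ← MonoidHom.mem_ker, ker_affineAction,
    ← ker_toMetacyclic h] at hx
  exact hx

end Affine

/-! ### The group chain of stabilizers and its discriminant groups -/

section Chain

variable {q d : ℕ}

/-- The chain of the stabilizers of `0 ∈ ℤ/dⁿ` under the affine actions of `BS(1,q)`. -/
noncomputable def affineChain (hd : 0 < d) (h : ∀ n, q.Coprime (d ^ n)) : GroupChain (BS q) where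
  grp n := Subgroup.closure {BS.tau q ^ d ^ n, BS.sigma q}
  grp_zero := by simpa using BS.closure_tau_sigma q
  antitone n n' hn g hg := by
    rw [← affineAction_apply_zero_eq_zero_iff (h n)]
    rw [← affineAction_apply_zero_eq_zero_iff (h n')] at hg
    have := affineAction_castHom (h n') (h n) (pow_dvd_pow d hn) g 0
    rw [hg, map_zero] at this
    exact this.symm
  finiteIndex n := by
    have : NeZero (d ^ n) := ⟨(pow_pos hd n).ne'⟩
    refine Subgroup.finiteIndex_of_le (H := (affineAction (h n)).ker) fun g hg => ?_
    rw [← affineAction_apply_zero_eq_zero_iff (h n), MonoidHom.mem_ker.1 hg]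
    rfl

variable (hd : 0 < d) (h : ∀ n, q.Coprime (d ^ n))

theorem mem_affineChain_grp {n : ℕ} {g : BS q} :
    g ∈ (affineChain hd h).grp n ↔ affineAction (h n) g 0 = 0 :=
  (affineAction_apply_zero_eq_zero_iff (h n) g).symm

theorem normalForm_mem_affineChain_grp {n i j : ℕ} {k : ℤ} :
    (BS.sigma q ^ i)⁻¹ * BS.tau q ^ k * BS.sigma q ^ j ∈ (affineChain hd h).grp n ↔
      (d : ℤ) ^ n ∣ k := by
  rw [mem_affineChain_grp, affineAction_fix_zero_iff, Nat.cast_pow]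

/-- The subgroup `C^m_n` fixes the orbit `d ^ m ℤ / d ^ n` of `0` under `G_m` pointwise. -/
theorem normalForm_mem_affineChain_core {m n : ℕ} (hmn : m ≤ n) {i j : ℕ} {k : ℤ} :
    (BS.sigma q ^ i)⁻¹ * BS.tau q ^ k * BS.sigma q ^ j ∈ (affineChain hd h).core m n ↔
      (d : ℤ) ^ n ∣ k ∧ (q : ZMod (d ^ (n - m))) ^ i = q ^ j := by
  have hconj : ∀ x g : BS q, g⁻¹ * x * g ∈ (affineChain hd h).grp n ↔
      affineAction (h n) x (affineAction (h n) g 0) = affineAction (h n) g 0 := by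
    intro x g
    rw [mem_affineChain_grp, map_mul, map_mul, map_inv, Equiv.Perm.mul_apply, Equiv.Perm.mul_apply,
      Equiv.Perm.inv_eq_iff_eq]
  have hd0 : (d : ℤ) ^ m ≠ 0 := pow_ne_zero _ (by exact_mod_cast hd.ne')
  -- Both conditions on `q` say that `d ^ n` divides `d ^ m * (q ^ i - q ^ j)`.
  have key : (q : ZMod (d ^ (n - m))) ^ i = q ^ j ↔
      (d : ZMod (d ^ n)) ^ m * (q ^ i - q ^ j) = 0 := by
    have h1 : (q : ZMod (d ^ (n - m))) ^ i = q ^ j ↔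
        ((d ^ (n - m) : ℕ) : ℤ) ∣ (q : ℤ) ^ i - q ^ j := by
      rw [← ZMod.intCast_zmod_eq_zero_iff_dvd, ← sub_eq_zero]; push_cast; rfl
    have h2 : (d : ZMod (d ^ n)) ^ m * (q ^ i - q ^ j) = 0 ↔
        ((d ^ n : ℕ) : ℤ) ∣ (d : ℤ) ^ m * ((q : ℤ) ^ i - q ^ j) := by
      rw [← ZMod.intCast_zmod_eq_zero_iff_dvd]; push_cast; rfl
    rw [h1, h2, ← Nat.add_sub_of_le hmn, pow_add, Nat.cast_mul, Nat.cast_pow, Nat.cast_pow,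
      mul_dvd_mul_iff_left hd0, Nat.add_sub_cancel_left, Nat.cast_pow]
  rw [GroupChain.mem_core, key]
  constructor
  · intro hx
    have hk : (d : ℤ) ^ n ∣ k := by
      have := hx 1 (one_mem _)
      rw [inv_one, one_mul, mul_one] at this
      exact (normalForm_mem_affineChain_grp hd h).1 this
    refine ⟨hk, ?_⟩
    have hτ : BS.tau q ^ ((d : ℤ) ^ m) ∈ (affineChain hd h).grp m := by
      simpa using (normalForm_mem_affineChain_grp hd h (n := m) (i := 0) (j := 0)).2
        (dvd_refl ((d : ℤ) ^ m))
    have h1 := (hconj _ _).1 (hx _ hτ)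
    rw [affineAction_tau_zpow, affineAction_normalForm,
      (ZMod.intCast_zmod_eq_zero_iff_dvd k (d ^ n)).2 (by exact_mod_cast hk)] at h1
    push_cast at h1
    linear_combination -h1
  · rintro ⟨hk, hq⟩ g hg
    rw [hconj, affineAction_normalForm,
      (ZMod.intCast_zmod_eq_zero_iff_dvd k (d ^ n)).2 (by exact_mod_cast hk)]
    obtain ⟨i', j', k', rfl⟩ := BS.exists_normalForm q g
    obtain ⟨l, hl⟩ := (normalForm_mem_affineChain_grp hd h).1 hg
    have h1 := (affineAction_normalForm (h n) i' j' k' 0 _).1 rfl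
    refine (isUnit_natCast_pow (h n) i').mul_left_cancel ?_
    rw [hl] at h1 ⊢
    push_cast at h1
    linear_combination (q ^ i - q ^ j : ZMod (d ^ n)) * h1 - l * hq

theorem affineChain_core_zero (n : ℕ) :
    (affineChain hd h).core 0 n =
      Subgroup.closure {BS.tau q ^ d ^ n, BS.sigma q ^ orderOf (q : ZMod (d ^ n))} := by
  have : NeZero (d ^ n) := ⟨(pow_pos hd n).ne'⟩
  rw [← ker_affineAction (h n)]
  ext x
  rw [GroupChain.mem_core, MonoidHom.mem_ker, (affineChain hd h).grp_zero]
  constructor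
  · intro hx
    refine Equiv.ext fun y => ?_
    obtain ⟨g, rfl⟩ := affineAction_transitive (h n) 0 y
    have := hx g (Subgroup.mem_top g)
    rw [mem_affineChain_grp, map_mul, map_mul, map_inv, Equiv.Perm.mul_apply, Equiv.Perm.mul_apply,
      Equiv.Perm.inv_eq_iff_eq] at this
    exact this
  · intro hx g _
    rw [mem_affineChain_grp, map_mul, map_mul, hx, mul_one, ← map_mul, inv_mul_cancel, map_one]
    rfl

theorem sigma_pow_mem_affineChain_grp (t n : ℕ) : BS.sigma q ^ t ∈ (affineChain hd h).grp n := by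
  rw [mem_affineChain_grp, affineAction_sigma_pow, mul_zero]

theorem sigma_pow_mem_affineChain_core {m n t : ℕ} (hmn : m ≤ n) :
    BS.sigma q ^ t ∈ (affineChain hd h).core m n ↔ (q : ZMod (d ^ (n - m))) ^ t = 1 := by
  have := normalForm_mem_affineChain_core hd h hmn (i := 0) (j := t) (k := 0)
  rw [pow_zero, inv_one, one_mul, zpow_zero, one_mul, pow_zero] at this
  rw [this, eq_comm (a := 1)]
  exact and_iff_right (dvd_zero _)

theorem affineChain_core_le_core {m k n n' : ℕ} (hmn : m ≤ n) (hkn : k ≤ n') (hnn : n ≤ n')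
    (hk : n - m ≤ n' - k) : (affineChain hd h).core k n' ≤ (affineChain hd h).core m n := by
  intro x hx
  obtain ⟨i, j, l, rfl⟩ := BS.exists_normalForm q x
  rw [normalForm_mem_affineChain_core hd h hkn] at hx
  rw [normalForm_mem_affineChain_core hd h hmn]
  refine ⟨(pow_dvd_pow _ hnn).trans hx.1, ?_⟩
  simpa only [map_pow, map_natCast] using
    congrArg (ZMod.castHom (pow_dvd_pow d hk) (ZMod (d ^ (n - m)))) hx.2

end Chain

namespace GroupChain

variable {G : Type*} [Group G] (S : GroupChain G)

instance (m : ℕ) (n : Set.Ici m) : DiscreteTopology (S.Quot m n) := ⟨rfl⟩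

theorem continuous_discMap {m k : ℕ} (h : m ≤ k) : Continuous (S.discMap h) := by
  refine Continuous.subtype_mk (continuous_pi fun n => ?_) _
  exact (continuous_of_discreteTopology (f := S.quotMap h n)).comp
    ((continuous_apply _).comp continuous_subtype_val)

/-- The map `G_{n'} / C^k_{n'} → G_n / C^m_n` induced by an inclusion `C^k_{n'} ⊆ C^m_n`. -/
def inclusionMap {m k : ℕ} {n : Set.Ici m} {n' : Set.Ici k} (hn : (n : ℕ) ≤ n')
    (hle : S.core k n' ≤ S.core m n) : S.Quot k n' →* S.Quot m n :=
  QuotientGroup.map _ _ (Subgroup.inclusion (S.antitone hn)) (by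
    intro x hx
    rw [Subgroup.mem_comap, Subgroup.mem_subgroupOf]
    rw [Subgroup.mem_subgroupOf] at hx
    exact hle hx)

/-- If `C^k_{n+k-m} ⊆ C^m_n` for all `n`, then the inclusions `G_{n+k-m} ⊆ G_n` induce an inverse of
the natural map `D^m → D^k`. -/
theorem isHomeomorph_discMap_of_core_le {m k : ℕ} (h : m ≤ k)
    (hle : ∀ n, m ≤ n → S.core k (n + (k - m)) ≤ S.core m n) :
    IsHomeomorph (S.discMap h) := by
  have hidx : ∀ n : Set.Ici m, k ≤ (n : ℕ) + (k - m) := fun n => by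
    have : m ≤ (n : ℕ) := n.2
    omega
  let shift := fun n : Set.Ici m =>
    S.inclusionMap (n := n) (n' := ⟨n + (k - m), hidx n⟩) (Nat.le_add_right _ _) (hle n n.2)
  have hbond : ∀ (n n' : Set.Ici m) (hn : n ≤ n') (y : S.Quot k ⟨n' + (k - m), hidx n'⟩),
      S.bond m hn (shift n' y) =
        shift n (S.bond k (n := ⟨n + (k - m), hidx n⟩) (n' := ⟨n' + (k - m), hidx n'⟩)
          (Nat.add_le_add_right hn _) y) := by
    intro n n' hn y
    induction y using QuotientGroup.induction_on
    rfl
  let inv : S.Disc k → S.Disc m := fun y =>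
    ⟨fun n => shift n (y.1 ⟨n + (k - m), hidx n⟩), fun n n' hn => by
      rw [hbond, y.2]⟩
  have hinv : Continuous inv := by
    refine Continuous.subtype_mk (continuous_pi fun n => ?_) _
    exact (continuous_of_discreteTopology (f := shift n)).comp
      ((continuous_apply _).comp continuous_subtype_val)
  have hleft : Function.LeftInverse inv (S.discMap h) := by
    intro x
    refine Subtype.ext (funext fun n => ?_)
    have key : ∀ y : S.Quot m ⟨n + (k - m), h.trans (hidx n)⟩,
        shift n (S.quotMap h ⟨n + (k - m), hidx n⟩ y) =
          S.bond m (n := n) (n' := ⟨n + (k - m), h.trans (hidx n)⟩) (Nat.le_add_right _ _) y := by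
      intro y
      induction y using QuotientGroup.induction_on
      rfl
    exact (key _).trans (x.2 _ _ _)
  have hright : Function.RightInverse inv (S.discMap h) := by
    intro y
    refine Subtype.ext (funext fun n => ?_)
    have key : ∀ z : S.Quot k ⟨n + (k - m), hidx ⟨n, h.trans n.2⟩⟩,
        S.quotMap h n (shift ⟨n, h.trans n.2⟩ z) =
          S.bond k (n := n) (n' := ⟨n + (k - m), hidx ⟨n, h.trans n.2⟩⟩)
            (Nat.le_add_right _ _) z := by
      intro z
      induction z using QuotientGroup.induction_on
      rfl
    exact (key _).trans (y.2 _ _ _)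
  exact (Homeomorph.mk ⟨S.discMap h, inv, hleft, hright⟩ (S.continuous_discMap h) hinv).isHomeomorph

theorem isClosed_disc (m : ℕ) : IsClosed (S.Disc m : Set (∀ n : Set.Ici m, S.Quot m n)) := by
  have : (S.Disc m : Set (∀ n : Set.Ici m, S.Quot m n)) =
      ⋂ (n : Set.Ici m) (n' : Set.Ici m) (h : n ≤ n'), {x | S.bond m h (x n') = x n} := by
    ext x; simp [Disc]
  rw [this]
  refine isClosed_iInter fun n => isClosed_iInter fun n' => isClosed_iInter fun h => ?_
  exact isClosed_eq ((continuous_of_discreteTopology (f := S.bond m h)).comp (continuous_apply _))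
    (continuous_apply _)

/-- An element of `⋂ G_n` defines an element of every discriminant group. -/
def toDisc (m : ℕ) (g : G) (hg : ∀ n, g ∈ S.grp n) : S.Disc m :=
  ⟨fun n => QuotientGroup.mk (⟨g, hg n⟩ : S.grp n), fun _ _ _ => rfl⟩

theorem finite_quot {m : ℕ} (n : Set.Ici m) [(S.core 0 n).FiniteIndex] : Finite (S.Quot m n) := by
  have : (S.core m n).FiniteIndex := Subgroup.finiteIndex_of_le (S.core_mono (Nat.zero_le m))
  exact Subgroup.finite_quotient_of_finiteIndex (H := (S.core m n).subgroupOf (S.grp n))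

theorem toDisc_apply_eq_one_iff {m : ℕ} {g : G} {hg : ∀ n, g ∈ S.grp n} {n : Set.Ici m} :
    (S.toDisc m g hg).1 n = 1 ↔ g ∈ S.core m n := by
  refine (QuotientGroup.eq_one_iff _).trans ?_
  rw [Subgroup.mem_subgroupOf]

/-- A discriminant group is a Cantor group if the quotients `G_n / C^m_n` are finite and `⋂ G_n`
has elements in `C^m_n` that lie outside some later `C^m_{n'}`, for every `n`. -/
theorem isCantorGroup_disc (m : ℕ) (hfin : ∀ n : Set.Ici m, Finite (S.Quot m n))
    (hinf : ∀ n, m ≤ n → ∃ g, (∀ n, g ∈ S.grp n) ∧ g ∈ S.core m n ∧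
      ∃ n', m ≤ n' ∧ g ∉ S.core m n') : IsCantorGroup (S.Disc m) := by
  refine ⟨inferInstance, ⟨1⟩, isCompact_iff_compactSpace.1 (S.isClosed_disc m).isCompact,
    inferInstance, ?_, ?_⟩
  · have : TopologicalSpace.MetrizableSpace (∀ n : Set.Ici m, S.Quot m n) := inferInstance
    exact Topology.IsEmbedding.subtypeVal.metrizableSpace
  rw [perfectSpace_iff_forall_not_isolated]
  intro x
  rw [← mem_closure_iff_nhdsWithin_neBot, mem_closure_iff]
  intro U hU hxU
  obtain ⟨V, hV, rfl⟩ := isOpen_induced_iff.1 hU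
  obtain ⟨I, u, hu, hIu⟩ := isOpen_pi_iff.1 hV _ hxU
  obtain ⟨n, hn⟩ := I.exists_le
  obtain ⟨g, hg, hgn, n', hn', hgn'⟩ := hinf n n.2
  refine ⟨x * S.toDisc m g hg, hIu fun a ha => ?_, fun hx => hgn' ?_⟩
  · have h1 : (S.toDisc m g hg).1 a = 1 :=
      S.toDisc_apply_eq_one_iff.2 (S.core_anti (hn a ha) hgn)
    have h2 : (x * S.toDisc m g hg).1 a = x.1 a * (S.toDisc m g hg).1 a := rfl
    rw [h2, h1, mul_one]
    exact (hu a ha).2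
  · have h1 : S.toDisc m g hg = 1 := by simpa using hx
    refine S.toDisc_apply_eq_one_iff (n := ⟨n', hn'⟩) (hg := hg) |>.1 ?_
    rw [h1]; rfl

end GroupChain

section Chain

variable {q d : ℕ}

/-- The order of `q` modulo `dⁿ` is unbounded since `dⁿ` divides `q ^ s - 1`. -/
theorem exists_lt_orderOf_natCast (hd : 1 < d) (hq : 1 < q) (h : ∀ n, q.Coprime (d ^ n)) (b : ℕ) :
    ∃ n, b < orderOf (q : ZMod (d ^ n)) := by
  refine ⟨q ^ b, ?_⟩
  by_contra! hle
  have : NeZero (d ^ q ^ b) := ⟨(pow_pos (by omega) _).ne'⟩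
  set s := orderOf (q : ZMod (d ^ q ^ b)) with hs
  have h0 : 0 < s := orderOf_natCast_pos (h _)
  have h1 : ((q ^ s : ℕ) : ZMod (d ^ q ^ b)) = (1 : ℕ) := by
    rw [Nat.cast_pow, hs, pow_orderOf_eq_one, Nat.cast_one]
  rw [ZMod.natCast_eq_natCast_iff] at h1
  have h2 := (Nat.modEq_iff_dvd' (Nat.one_le_pow _ _ (by omega))).1 h1.symm
  have h3 : 1 < q ^ s := Nat.one_lt_pow h0.ne' hq
  have h4 := Nat.le_of_dvd (by omega) h2
  have h5 : q ^ s ≤ q ^ b := Nat.pow_le_pow_right (by omega) hle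
  have h6 : q ^ b < d ^ q ^ b := Nat.lt_pow_self hd
  omega

theorem monotone_orderOf_natCast (hd : 1 < d) (h : ∀ n, q.Coprime (d ^ n)) :
    Monotone fun n => orderOf (q : ZMod (d ^ n)) := by
  intro n n' hn
  have : NeZero (d ^ n') := ⟨(pow_pos (by omega) _).ne'⟩
  refine Nat.le_of_dvd (orderOf_natCast_pos (h _)) ?_
  simpa using orderOf_map_dvd
    (ZMod.castHom (pow_dvd_pow d hn) (ZMod (d ^ n)) : ZMod (d ^ n') →* ZMod (d ^ n)) (q : ZMod (d ^ n'))

theorem isCantorGroup_affineChain_disc (hd : 1 < d) (hq : 1 < q) (h : ∀ n, q.Coprime (d ^ n))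
    (m : ℕ) : IsCantorGroup ((affineChain (zero_lt_one.trans hd) h).Disc m) := by
  have hd0 : 0 < d := zero_lt_one.trans hd
  refine GroupChain.isCantorGroup_disc _ m (fun n => ?_) fun n hn => ?_
  · have : NeZero (d ^ (n : ℕ)) := ⟨(pow_pos hd0 _).ne'⟩
    have : ((affineChain hd0 h).core 0 n).FiniteIndex := by
      rw [affineChain_core_zero, ← ker_affineAction (h n)]
      infer_instance
    exact GroupChain.finite_quot _ n
  · have : NeZero (d ^ (n - m)) := ⟨(pow_pos hd0 _).ne'⟩
    obtain ⟨l, hl⟩ := exists_lt_orderOf_natCast hd hq h (orderOf (q : ZMod (d ^ (n - m))))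
    refine ⟨BS.sigma q ^ orderOf (q : ZMod (d ^ (n - m))), sigma_pow_mem_affineChain_grp hd0 h _,
      (sigma_pow_mem_affineChain_core hd0 h hn).2 (pow_orderOf_eq_one _), m + l, Nat.le_add_right _ _, ?_⟩
    rw [sigma_pow_mem_affineChain_core hd0 h (Nat.le_add_right _ _), Nat.add_sub_cancel_left]
    exact pow_ne_one_of_lt_orderOf (orderOf_natCast_pos (h _)).ne' hl

theorem isHomeomorph_affineChain_discMap (hd : 0 < d) (h : ∀ n, q.Coprime (d ^ n)) {m k : ℕ}
    (hmk : m ≤ k) : IsHomeomorph ((affineChain hd h).discMap hmk) :=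
  GroupChain.isHomeomorph_discMap_of_core_le _ hmk fun n hn =>
    affineChain_core_le_core hd h hn (by omega) (by omega) (by omega)

end Chain

/-! ### The extension of the `p`-adic valuation -/

section Valuation

open scoped NNReal

variable (p : ℕ) [Fact p.Prime]

/-- The extension of the `p`-adic absolute value to an algebraic extension of `ℚ_p`, given by the
spectral norm. -/
noncomputable def padicExtension (L : Type*) [Field L] [Algebra ℚ_[p] L]
    [Algebra.IsAlgebraic ℚ_[p] L] : Valuation L ℝ≥0 where
  toFun x := ⟨spectralNorm ℚ_[p] L x, spectralNorm_nonneg x⟩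
  map_zero' := Subtype.ext (spectralNorm_zero (K := ℚ_[p]))
  map_one' := Subtype.ext (spectralNorm_one (K := ℚ_[p]))
  map_mul' x y := Subtype.ext (map_mul (spectralMulAlgNorm (K := ℚ_[p]) (L := L)) x y)
  map_add_le_max' x y := isNonarchimedean_spectralNorm (K := ℚ_[p]) (L := L) x y

theorem coe_padicExtension {L : Type*} [Field L] [Algebra ℚ_[p] L]
    [Algebra.IsAlgebraic ℚ_[p] L] (x : L) :
    (padicExtension p L x : ℝ) = spectralNorm ℚ_[p] L x := rfl

theorem padicExtension_p_lt_one {L : Type*} [Field L] [Algebra ℚ_[p] L]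
    [Algebra.IsAlgebraic ℚ_[p] L] : padicExtension p L (p : L) < 1 := by
  rw [← NNReal.coe_lt_coe, coe_padicExtension, ← map_natCast (algebraMap ℚ_[p] L) p,
    spectralNorm_extends, NNReal.coe_one]
  exact Padic.norm_p_lt_one

theorem padicExtension_le_one_iff {L : Type*} [Field L] [Algebra ℚ_[p] L]
    [Algebra.IsAlgebraic ℚ_[p] L] [Algebra ℤ_[p] L] [IsScalarTower ℤ_[p] ℚ_[p] L] (x : L) :
    padicExtension p L x ≤ 1 ↔ IsIntegral ℤ_[p] x := by
  have hx : IsIntegral ℚ_[p] x := Algebra.IsIntegral.isIntegral x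
  rw [← NNReal.coe_le_coe, coe_padicExtension, NNReal.coe_one, spectralNorm,
    spectralValue_le_one_iff (minpoly.monic hx)]
  constructor
  · intro h
    have hl : minpoly ℚ_[p] x ∈ Polynomial.lifts (algebraMap ℤ_[p] ℚ_[p]) := by
      rw [Polynomial.lifts_iff_coeff_lifts]
      exact fun n => ⟨⟨_, h n⟩, rfl⟩
    obtain ⟨P, hP, -, hm⟩ := Polynomial.lifts_and_degree_eq_and_monic hl (minpoly.monic hx)
    refine ⟨P, hm, ?_⟩
    have := minpoly.aeval ℚ_[p] x
    rw [← hP, Polynomial.aeval_map_algebraMap] at this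
    exact this
  · intro h n
    rw [minpoly.isIntegrallyClosed_eq_field_fractions' ℚ_[p] h, Polynomial.coeff_map]
    exact PadicInt.norm_le_one _

/-- The quotient of the free `ℤ_p`-module of rank `m` by the multiples of `p` has `p ^ m`
elements. -/
theorem index_range_p_smul (M : Type*) [AddCommGroup M] [Module ℤ_[p] M] [Module.Free ℤ_[p] M]
    [Module.Finite ℤ_[p] M] :
    (AddMonoidHom.range (nsmulAddMonoidHom (α := M) p)).index =
      p ^ Module.finrank ℤ_[p] M := by
  let b := Module.Free.chooseBasis ℤ_[p] M
  let φ : M →+ (Module.Free.ChooseBasisIndex ℤ_[p] M → ZMod p) :=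
    ((PadicInt.toZMod (p := p)).toAddMonoidHom.compLeft _).comp
      (b.equivFun : M →+ (Module.Free.ChooseBasisIndex ℤ_[p] M → ℤ_[p]))
  have hφ : ∀ x i, φ x i = PadicInt.toZMod (b.equivFun x i) := fun _ _ => rfl
  have hsurj : Function.Surjective φ := by
    intro y
    choose z hz using fun i => ZMod.ringHom_surjective (PadicInt.toZMod (p := p)) (y i)
    refine ⟨b.equivFun.symm z, funext fun i => ?_⟩
    rw [hφ, LinearEquiv.apply_symm_apply, hz]
  have hker : AddMonoidHom.range (nsmulAddMonoidHom (α := M) p) = φ.ker := by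
    ext x
    rw [AddMonoidHom.mem_ker]
    constructor
    · rintro ⟨y, rfl⟩
      ext i
      simp [hφ]
    · intro hx
      have h1 : ∀ i, ∃ c, b.equivFun x i = p * c := fun i => by
        have h2 : b.equivFun x i ∈ RingHom.ker (PadicInt.toZMod (p := p)) := by
          rw [RingHom.mem_ker, ← hφ, hx]; rfl
        rw [PadicInt.ker_toZMod, PadicInt.maximalIdeal_eq_span_p,
          Ideal.mem_span_singleton] at h2
        exact h2
      choose c hc using h1
      refine ⟨b.equivFun.symm c, b.equivFun.injective (funext fun i => ?_)⟩
      rw [hc i, nsmulAddMonoidHom_apply, map_nsmul, Pi.smul_apply, LinearEquiv.apply_symm_apply,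
        nsmul_eq_mul]
  rw [hker, AddSubgroup.index_ker, AddMonoidHom.range_eq_top.2 hsurj]
  simp [Nat.card_eq_fintype_card, Module.finrank_eq_card_chooseBasisIndex]

/-- In an unramified extension, `p` generates the maximal ideal of the ring of integers: the ideals
`(p)` and `M` are contained in one another and have the same index `p ^ m`. -/
theorem IsUnramifiedOfDegree.exists_isMaximal {K : Type*} [Field K] [Algebra ℚ_[p] K]
    [Algebra ℤ_[p] K] [IsScalarTower ℤ_[p] ℚ_[p] K] [FiniteDimensional ℚ_[p] K] {m : ℕ}
    (hK : IsUnramifiedOfDegree p K m) :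
    0 < m ∧ (Ideal.span {(p : integralClosure ℤ_[p] K)}).IsMaximal ∧
      Nat.card (integralClosure ℤ_[p] K ⧸ Ideal.span {(p : integralClosure ℤ_[p] K)}) = p ^ m := by
  obtain ⟨hm, M, hM, hcard⟩ := hK
  have hm0 : 0 < m := hm ▸ Module.finrank_pos
  have hp : p.Prime := Fact.out
  have : Module.IsTorsionFree ℤ_[p] K := Module.IsTorsionFree.trans_faithfulSMul ℤ_[p] ℚ_[p] K
  have : Module.Free ℤ_[p] (integralClosure ℤ_[p] K) :=
    IsIntegralClosure.module_free ℤ_[p] ℚ_[p] K _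
  have : Module.Finite ℤ_[p] (integralClosure ℤ_[p] K) :=
    IsIntegralClosure.finite ℤ_[p] ℚ_[p] K _
  have hrank : Module.finrank ℤ_[p] (integralClosure ℤ_[p] K) = m :=
    (IsIntegralClosure.rank ℤ_[p] ℚ_[p] K _).trans hm
  have hidx := index_range_p_smul p (integralClosure ℤ_[p] K)
  rw [hrank] at hidx
  have hpM : (p : integralClosure ℤ_[p] K) ∈ M := by
    have h1 : ((p ^ m : ℕ) : integralClosure ℤ_[p] K) ∈ M := by
      have : Finite (integralClosure ℤ_[p] K ⧸ M) :=
        Nat.finite_of_card_ne_zero (by rw [hcard]; exact (pow_pos hp.pos m).ne')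
      rw [← Ideal.Quotient.eq_zero_iff_mem, map_natCast, ← hcard, ← nsmul_one]
      exact card_nsmul_eq_zero'
    rw [Nat.cast_pow] at h1
    exact hM.isPrime.mem_of_pow_mem _ h1
  have hspan : (Ideal.span {(p : integralClosure ℤ_[p] K)}).toAddSubgroup =
      AddMonoidHom.range (nsmulAddMonoidHom (α := integralClosure ℤ_[p] K) p) := by
    ext x
    rw [Submodule.mem_toAddSubgroup, Ideal.mem_span_singleton]
    simp [dvd_iff_exists_eq_mul_right, eq_comm]
  have hle : (Ideal.span {(p : integralClosure ℤ_[p] K)}) ≤ M := by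
    rwa [Ideal.span_singleton_le_iff_mem]
  have hMidx : M.toAddSubgroup.index = p ^ m := hcard
  have heq : (Ideal.span {(p : integralClosure ℤ_[p] K)}) = M := by
    refine le_antisymm hle ?_
    have h1 := AddSubgroup.relIndex_mul_index
      (H := (Ideal.span {(p : integralClosure ℤ_[p] K)}).toAddSubgroup)
      (K := M.toAddSubgroup) hle
    rw [hMidx, hspan, hidx, ← hspan] at h1
    have h2 := Nat.eq_of_mul_eq_mul_right (pow_pos hp.pos m) (h1.trans (one_mul _).symm)
    exact AddSubgroup.relIndex_eq_one.1 h2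
  rw [heq]
  exact ⟨hm0, hM, hcard⟩

/-- A Galois invariant valuation of `L` for which `p` is a uniformizer of the valuation ring of `K`
and the residue field of `K` has `q` elements. The residue field of `K` enters through its
characterization inside the residue field of `L`, as the set of the solutions of `x ^ q = x`. -/
structure IsUnramifiedValuation (K : Type*) {L : Type*} [Field K] [Field L] [Algebra K L]
    (v : Valuation L ℝ≥0) (p q : ℕ) : Prop where
  map_galois (g : L ≃ₐ[K] L) (x : L) : v (g x) = v x
  map_p_lt_one : v p < 1
  map_p_ne_zero : v p ≠ 0
  le_map_p (x : K) : v (algebraMap K L x) < 1 → v (algebraMap K L x) ≤ v p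
  map_pow_card_sub (x : K) :
    v (algebraMap K L x) ≤ 1 → v (algebraMap K L x ^ q - algebraMap K L x) < 1
  exists_approx (x : L) : v x ≤ 1 → v (x ^ q - x) < 1 →
    ∃ y : K, v (algebraMap K L y) ≤ 1 ∧ v (x - algebraMap K L y) < 1

theorem mem_maximalIdeal_valuationSubring_iff {L Γ : Type*} [Field L]
    [LinearOrderedCommGroupWithZero Γ] (v : Valuation L Γ) (x : v.valuationSubring) :
    x ∈ IsLocalRing.maximalIdeal v.valuationSubring ↔ v x < 1 := by
  rw [IsLocalRing.mem_maximalIdeal, mem_nonunits_iff,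
    (Valuation.valuationSubring.integers v).isUnit_iff_valuation_eq_one]
  exact ⟨fun h => lt_of_le_of_ne x.2 h, fun h => h.ne⟩

theorem residue_eq_residue_iff {L Γ : Type*} [Field L]
    [LinearOrderedCommGroupWithZero Γ] (v : Valuation L Γ) (x y : v.valuationSubring) :
    IsLocalRing.residue v.valuationSubring x = IsLocalRing.residue v.valuationSubring y ↔
      v ((x : L) - y) < 1 := by
  rw [← sub_eq_zero, ← map_sub, IsLocalRing.residue_eq_zero_iff,
    mem_maximalIdeal_valuationSubring_iff]
  rfl

theorem isUnramifiedValuation_padicExtension {K L : Type*} [Field K] [Algebra ℚ_[p] K]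
    [Algebra ℤ_[p] K] [IsScalarTower ℤ_[p] ℚ_[p] K] [FiniteDimensional ℚ_[p] K] {m : ℕ}
    (hK : IsUnramifiedOfDegree p K m) [Field L] [Algebra K L] [Algebra ℚ_[p] L]
    [IsScalarTower ℚ_[p] K L] [Algebra.IsAlgebraic ℚ_[p] L] :
    IsUnramifiedValuation K (padicExtension p L) p (p ^ m) := by
  obtain ⟨hm, hmax, hcard⟩ := hK.exists_isMaximal
  set v := padicExtension p L
  set O := integralClosure ℤ_[p] K
  have hp : p.Prime := Fact.out
  have hp1 : v (p : L) < 1 := padicExtension_p_lt_one p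
  have hv : ∀ x : K, v (algebraMap K L x) = padicExtension p K x := fun x =>
    Subtype.ext (spectralNorm.eq_of_tower (K := ℚ_[p]) (L := L) x).symm
  have hint : ∀ x : K, v (algebraMap K L x) ≤ 1 ↔ x ∈ O := fun x => by
    rw [hv, padicExtension_le_one_iff]; rfl
  -- The map from the ring of integers of `K` to the residue field of `L`.
  let ι : O →+* v.valuationSubring :=
    ((algebraMap K L).comp (algebraMap O K)).codRestrict v.valuationSubring.toSubring
      fun x => (hint x).2 x.2
  let r : O →+* IsLocalRing.ResidueField v.valuationSubring :=
    (IsLocalRing.residue v.valuationSubring).comp ι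
  have hr : ∀ x y, r x = r y ↔ v (algebraMap K L x - algebraMap K L y) < 1 := fun x y =>
    residue_eq_residue_iff v (ι x) (ι y)
  have hrp : r p = 0 := by
    rw [← map_zero r, hr]
    simpa using hp1
  have hker : RingHom.ker r = Ideal.span {(p : O)} := by
    refine (hmax.eq_of_le (RingHom.ker_ne_top r) ?_).symm
    rw [Ideal.span_singleton_le_iff_mem]
    exact hrp
  have : Fintype r.range := by
    have : Finite (O ⧸ RingHom.ker r) :=
      Nat.finite_of_card_ne_zero (by rw [hker, hcard]; exact (pow_pos hp.pos m).ne')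
    have : Finite r.range := Finite.of_equiv _ (RingHom.quotientKerEquivRange r).toEquiv
    exact Fintype.ofFinite _
  have hcardr : Fintype.card r.range = p ^ m := by
    rw [← Nat.card_eq_fintype_card, ← Nat.card_congr (RingHom.quotientKerEquivRange r).toEquiv,
      hker, hcard]
  have hpow : ∀ x : O, r x ^ p ^ m = r x := by
    intro x
    have : IsField r.range := (RingHom.quotientKerEquivRange r).symm.toMulEquiv.isField
      ((Ideal.Quotient.maximal_ideal_iff_isField_quotient _).1 (hker ▸ hmax))
    let := this.toField
    have h1 := FiniteField.pow_card (⟨r x, x, rfl⟩ : r.range)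
    rw [hcardr] at h1
    exact congrArg Subtype.val h1
  refine ⟨fun g x => ?_, hp1, ?_, fun x hx => ?_, fun x hx => ?_, fun x hx hxq => ?_⟩
  · exact Subtype.ext (spectralNorm_eq_of_equiv (g.restrictScalars ℚ_[p]) x).symm
  · rw [v.ne_zero_iff]
    have : CharZero L := charZero_of_injective_algebraMap (algebraMap ℚ_[p] L).injective
    exact_mod_cast hp.ne_zero
  · have h1 : (⟨x, (hint x).1 hx.le⟩ : O) ∈ RingHom.ker r := by
      rw [RingHom.mem_ker, ← map_zero r, hr]
      simpa using hx
    rw [hker, Ideal.mem_span_singleton] at h1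
    obtain ⟨c, hc⟩ := h1
    have h2 : x = p * c := by simpa using congrArg (algebraMap O K) hc
    rw [h2, map_mul, map_natCast, map_mul]
    exact mul_le_of_le_one_right' ((hint _).2 c.2)
  · have := hpow ⟨x, (hint x).1 hx⟩
    rw [← map_pow, hr] at this
    simpa using this
  · -- The `q` elements of the residue field of `K` exhaust the roots of `X ^ q - X`.
    have hq : 1 < p ^ m := Nat.one_lt_pow hm.ne' hp.one_lt
    let R := IsLocalRing.ResidueField v.valuationSubring
    set z : R := IsLocalRing.residue v.valuationSubring ⟨x, hx⟩ with hz
    have hzq : z ^ p ^ m = z := by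
      rw [hz, ← map_pow, residue_eq_residue_iff]
      exact hxq
    have hne : (X ^ p ^ m - X : R[X]) ≠ 0 := FiniteField.X_pow_card_sub_X_ne_zero R hq
    have hroot : ∀ y : R, y ∈ (X ^ p ^ m - X : R[X]).roots ↔ y ^ p ^ m = y := fun y => by
      rw [mem_roots hne, IsRoot.def, eval_sub, eval_pow, eval_X, sub_eq_zero]
    classical
    have hsub : (r.range : Set R).toFinset ⊆ (X ^ p ^ m - X : R[X]).roots.toFinset := by
      intro y hy
      rw [Set.mem_toFinset] at hy
      obtain ⟨b, rfl⟩ := hy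
      rw [Multiset.mem_toFinset, hroot, hpow]
    have hle : (X ^ p ^ m - X : R[X]).roots.toFinset.card ≤ (r.range : Set R).toFinset.card := by
      rw [Set.toFinset_card]
      refine (Multiset.toFinset_card_le _).trans ((card_roots' _).trans ?_)
      rw [FiniteField.X_pow_card_sub_X_natDegree_eq R hq]
      exact hcardr.ge
    have hzr : z ∈ (r.range : Set R).toFinset := by
      rw [Finset.eq_of_subset_of_card_le hsub hle, Multiset.mem_toFinset, hroot, hzq]
    rw [Set.mem_toFinset] at hzr
    obtain ⟨y, hy⟩ := hzr
    refine ⟨y, (hint _).2 y.2, ?_⟩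
    have h1 : IsLocalRing.residue v.valuationSubring ⟨x, hx⟩ =
      IsLocalRing.residue v.valuationSubring (ι y) := hy.symm
    rwa [residue_eq_residue_iff] at h1

end Valuation

/-! ### The Galois action on roots of unity and on radicals of `p` -/

section Galois

open scoped NNReal

namespace IsUnramifiedValuation

variable {K L : Type*} [Field K] [Field L] [Algebra K L] {v : Valuation L ℝ≥0} {p m N : ℕ}

theorem map_natCast_le_one (v : Valuation L ℝ≥0) (n : ℕ) : v (n : L) ≤ 1 := by
  induction n with
  | zero => simp
  | succ n ih => rw [Nat.cast_succ]; exact v.map_add_le ih v.map_one.le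

theorem map_natCast_eq_one {q : ℕ} (hv : IsUnramifiedValuation K v p q) {n : ℕ}
    (hn : n.Coprime p) : v (n : L) = 1 := by
  refine le_antisymm (map_natCast_le_one v n) ?_
  by_contra! hlt
  have h1 : (1 : L) = n * (n.gcdA p : ℤ) + p * (n.gcdB p : ℤ) := by
    have := Nat.gcd_eq_gcd_ab n p
    rw [hn.gcd_eq_one] at this
    exact_mod_cast congrArg (Int.cast : ℤ → L) this
  have hint : ∀ a : ℤ, v (a : L) ≤ 1 := by
    intro a
    obtain ⟨b, rfl | rfl⟩ := a.eq_nat_or_neg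
    · simpa using map_natCast_le_one v b
    · simpa using map_natCast_le_one v b
  have h2 : v (1 : L) < 1 := by
    rw [h1]
    refine v.map_add_lt ?_ ?_ <;> rw [map_mul]
    · exact mul_lt_one_of_lt_of_le hlt (hint _)
    · exact mul_lt_one_of_lt_of_le hv.map_p_lt_one (hint _)
  exact h2.ne v.map_one

theorem map_eq_one_of_pow_eq_one (v : Valuation L ℝ≥0) (hN : N ≠ 0) {x : L} (hx : x ^ N = 1) :
    v x = 1 :=
  (pow_eq_one_iff_of_nonneg zero_le hN).1 (by rw [← map_pow, hx, map_one])

/-- Roots of unity of order prime to `p` are determined by their residues. -/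
theorem eq_of_map_sub_lt_one {q : ℕ} (hv : IsUnramifiedValuation K v p q) (hN0 : N ≠ 0)
    (hN : N.Coprime p) {x y : L} (hx : x ^ N = 1) (hy : y ^ N = 1) (hxy : v (x - y) < 1) :
    x = y := by
  by_contra hne
  have hx1 := map_eq_one_of_pow_eq_one v hN0 hx
  have hy1 := map_eq_one_of_pow_eq_one v hN0 hy
  set a : v.valuationSubring := ⟨x, hx1.le⟩
  set b : v.valuationSubring := ⟨y, hy1.le⟩
  have hab : IsLocalRing.residue v.valuationSubring a = IsLocalRing.residue v.valuationSubring b :=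
    (residue_eq_residue_iff v a b).2 hxy
  have hsum : ∑ i ∈ Finset.range N, a ^ i * b ^ (N - 1 - i) = 0 := by
    have h1 := geom_sum₂_mul a b N
    have h2 : a ^ N - b ^ N = 0 := Subtype.ext (by simp [a, b, hx, hy])
    have h3 : a - b ≠ 0 := fun h => hne (sub_eq_zero.1 (congrArg Subtype.val h))
    rw [h2] at h1
    exact (mul_eq_zero.1 h1).resolve_right h3
  have h4 := congrArg (IsLocalRing.residue v.valuationSubring) hsum
  rw [map_sum] at h4
  have h5 : ∀ i ∈ Finset.range N, IsLocalRing.residue v.valuationSubring (a ^ i * b ^ (N - 1 - i)) =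
      IsLocalRing.residue v.valuationSubring (b ^ (N - 1)) := by
    intro i hi
    have := Finset.mem_range.1 hi
    rw [map_mul, map_pow, hab, ← map_pow, ← map_mul, ← pow_add]
    congr 2
    omega
  rw [Finset.sum_congr rfl h5, Finset.sum_const, Finset.card_range, ← map_nsmul,
    residue_eq_residue_iff] at h4
  have h6 : v ((N : L) * y ^ (N - 1)) < 1 := by simpa [b] using h4
  rw [map_mul, map_pow, hy1, hv.map_natCast_eq_one hN] at h6
  simp at h6

theorem charP_residueField {q : ℕ} (hv : IsUnramifiedValuation K v p q) (hp : p.Prime) :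
    CharP (IsLocalRing.ResidueField v.valuationSubring) p := by
  rw [CharP.charP_iff_prime_eq_zero hp]
  have := (residue_eq_residue_iff v (p : v.valuationSubring) 0).2 (by simpa using hv.map_p_lt_one)
  simpa using this

/-- The restriction of an automorphism to the valuation ring. -/
noncomputable def integerMap {q : ℕ} (hv : IsUnramifiedValuation K v p q) (g : L ≃ₐ[K] L) :
    v.valuationSubring →+* v.valuationSubring :=
  ((g : L →+* L).comp v.valuationSubring.subtype).codRestrict v.valuationSubring.toSubring
    fun x => (hv.map_galois g x).trans_le x.2

theorem coe_integerMap {q : ℕ} (hv : IsUnramifiedValuation K v p q) (g : L ≃ₐ[K] L)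
    (x : v.valuationSubring) : (hv.integerMap g x : L) = g x := rfl

/-- The automorphism of the residue field that is induced by an automorphism. -/
noncomputable def residueMap {q : ℕ} (hv : IsUnramifiedValuation K v p q) (g : L ≃ₐ[K] L) :
    IsLocalRing.ResidueField v.valuationSubring →+* IsLocalRing.ResidueField v.valuationSubring :=
  Ideal.Quotient.lift _ ((IsLocalRing.residue v.valuationSubring).comp (hv.integerMap g)) (by
    intro x hx
    rw [RingHom.comp_apply, IsLocalRing.residue_eq_zero_iff, mem_maximalIdeal_valuationSubring_iff,
      coe_integerMap, hv.map_galois]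
    exact (mem_maximalIdeal_valuationSubring_iff v x).1 hx)

theorem residueMap_residue {q : ℕ} (hv : IsUnramifiedValuation K v p q) (g : L ≃ₐ[K] L)
    (x : v.valuationSubring) :
    hv.residueMap g (IsLocalRing.residue v.valuationSubring x) =
      IsLocalRing.residue v.valuationSubring (hv.integerMap g x) := rfl

/-- Every automorphism raises roots of unity of order prime to `p` to a power of `q`: modulo the
maximal ideal, the polynomial with the roots `z ^ q ^ i` has coefficients in the residue field of
`K`, which are fixed by the automorphism. Invariance of the valuation is what excludes other
powers. -/
theorem exists_galois_eq_pow (hv : IsUnramifiedValuation K v p (p ^ m)) (hp : p.Prime)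
    (hN0 : N ≠ 0) (hN : N.Coprime p) {ζ : L} (hζ : ζ ^ N = 1) (g : L ≃ₐ[K] L) :
    ∃ i : ℕ, g ζ = ζ ^ (p ^ m) ^ i := by
  have := hv.charP_residueField hp
  have : Fact p.Prime := ⟨hp⟩
  set r := IsLocalRing.residue v.valuationSubring
  set ζ' : v.valuationSubring := ⟨ζ, (map_eq_one_of_pow_eq_one v hN0 hζ).le⟩
  set z := r ζ'
  set q := p ^ m
  set φ := iterateFrobenius (IsLocalRing.ResidueField v.valuationSubring) p m
  have hφ : ∀ x, φ x = x ^ q := fun x => iterateFrobenius_def p m x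
  have hzN : z ^ N = 1 := by
    rw [← map_pow, ← map_one r]
    exact congrArg r (Subtype.ext hζ)
  set s := N.totient
  have hs : 0 < s := Nat.totient_pos.2 (Nat.pos_of_ne_zero hN0)
  have hzs : z ^ q ^ s = z := by
    have h1 : q ^ s ≡ 1 [MOD N] := Nat.ModEq.pow_totient (hN.symm.pow_left m)
    rw [← pow_mod_orderOf, (h1.of_dvd (orderOf_dvd_of_pow_eq_one hzN)), pow_mod_orderOf, pow_one]
  set H : (IsLocalRing.ResidueField v.valuationSubring)[X] :=
    ∏ i ∈ Finset.range s, (X - C (z ^ q ^ i)) with hH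
  have hHφ : H.map φ = H := by
    have h1 : H.map φ = ∏ i ∈ Finset.range s, (X - C (z ^ q ^ (i + 1))) := by
      rw [hH, Polynomial.map_prod]
      refine Finset.prod_congr rfl fun i _ => ?_
      rw [Polynomial.map_sub, map_X, map_C, hφ, ← pow_mul, pow_succ]
    have h2 := Finset.prod_range_succ (fun i => X - C (z ^ q ^ i)) s
    rw [Finset.prod_range_succ', ← h1, ← hH, hzs, pow_zero, pow_one] at h2
    exact mul_right_cancel₀ (X_sub_C_ne_zero z) h2
  have hHg : H.map (hv.residueMap g) = H := by
    ext i
    rw [coeff_map]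
    obtain ⟨x, hx⟩ := IsLocalRing.residue_surjective (R := v.valuationSubring) (H.coeff i)
    have h1 : r (x ^ q) = r x := by
      change r x = _ at hx
      rw [map_pow, hx, ← hφ, ← coeff_map, hHφ]
    obtain ⟨y, hy, hxy⟩ := hv.exists_approx x x.2 ((residue_eq_residue_iff v _ _).1 h1)
    have h2 : H.coeff i = r ⟨algebraMap K L y, hy⟩ :=
      hx.symm.trans ((residue_eq_residue_iff v x ⟨algebraMap K L y, hy⟩).2 hxy)
    rw [h2, residueMap_residue]
    exact congrArg r (Subtype.ext (g.commutes y))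
  have hHz : H.eval (r (hv.integerMap g ζ')) = 0 := by
    rw [← residueMap_residue, ← hHg, eval_map, eval₂_hom, hH, eval_prod,
      Finset.prod_eq_zero (Finset.mem_range.2 hs), map_zero]
    simp [z, r]
  rw [hH, eval_prod, Finset.prod_eq_zero_iff] at hHz
  obtain ⟨i, -, hi⟩ := hHz
  rw [eval_sub, eval_X, eval_C, sub_eq_zero, ← map_pow, residue_eq_residue_iff] at hi
  refine ⟨i, hv.eq_of_map_sub_lt_one hN0 hN ?_ ?_ hi⟩
  · rw [← map_pow, hζ, map_one]
  · rw [← pow_mul, mul_comm, pow_mul, hζ, one_pow]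

theorem pow_apply_of_fixed {g : L ≃ₐ[K] L} {ζ π : L} (hζ : g ζ = ζ) {a : ℕ}
    (hπ : g π = ζ ^ a * π) (k : ℕ) : (g ^ k) π = ζ ^ (a * k) * π := by
  induction k with
  | zero => simp
  | succ k ih =>
    rw [pow_succ', AlgEquiv.mul_apply, ih, map_mul, map_pow, hζ, hπ]
    ring

variable [FiniteDimensional K L] [IsGalois K L]

/-- Some automorphism raises roots of unity of order prime to `p` to the power `q`: the
polynomial with the roots `g ζ` has coefficients in `K`, so modulo the maximal ideal its set of
roots is stable under `x ↦ x ^ q`. -/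
theorem exists_galois_frobenius (hv : IsUnramifiedValuation K v p (p ^ m)) (hp : p.Prime)
    (hN0 : N ≠ 0) (hN : N.Coprime p) {ζ : L} (hζ : ζ ^ N = 1) :
    ∃ g : L ≃ₐ[K] L, g ζ = ζ ^ p ^ m := by
  have := hv.charP_residueField hp
  have : Fact p.Prime := ⟨hp⟩
  set r := IsLocalRing.residue v.valuationSubring
  set ζ' : v.valuationSubring := ⟨ζ, (map_eq_one_of_pow_eq_one v hN0 hζ).le⟩
  set q := p ^ m
  set φ := iterateFrobenius (IsLocalRing.ResidueField v.valuationSubring) p m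
  have hφ : ∀ x, φ x = x ^ q := fun x => iterateFrobenius_def p m x
  set F : (v.valuationSubring)[X] := ∏ g : L ≃ₐ[K] L, (X - C (hv.integerMap g ζ')) with hF
  have hFg : ∀ g : L ≃ₐ[K] L, F.map (hv.integerMap g) = F := by
    intro g
    rw [hF, Polynomial.map_prod]
    refine Fintype.prod_equiv (Equiv.mulLeft g) _ _ fun h => ?_
    rw [Polynomial.map_sub, map_X, map_C]
    rfl
  have hFφ : (F.map r).map φ = F.map r := by
    ext i
    rw [coeff_map, coeff_map, hφ, ← map_pow, residue_eq_residue_iff]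
    have h1 : (F.coeff i : L) ∈ Set.range (algebraMap K L) := by
      rw [IsGalois.mem_range_algebraMap_iff_fixed]
      intro g
      rw [← coe_integerMap hv, ← coeff_map, hFg]
    obtain ⟨y, hy⟩ := h1
    have h2 : v (algebraMap K L y) ≤ 1 := hy ▸ (F.coeff i).2
    have h3 := hv.map_pow_card_sub y h2
    rw [hy] at h3
    exact h3
  have hFz : (F.map r).eval (φ (r ζ')) = 0 := by
    rw [← hFφ, eval_map, eval₂_hom, eval_map, eval₂_hom, hF, eval_prod,
      Finset.prod_eq_zero (Finset.mem_univ 1), map_zero, map_zero]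
    rw [eval_sub, eval_X, eval_C, sub_eq_zero]
    rfl
  rw [eval_map, hφ, ← map_pow, eval₂_hom, hF, eval_prod, map_prod, Finset.prod_eq_zero_iff] at hFz
  obtain ⟨g, -, hg⟩ := hFz
  rw [eval_sub, eval_X, eval_C, map_sub, sub_eq_zero, residue_eq_residue_iff] at hg
  refine ⟨g, (hv.eq_of_map_sub_lt_one hN0 hN ?_ ?_ hg).symm⟩
  · rw [SubmonoidClass.coe_pow, ← pow_mul, mul_comm, pow_mul, hζ, one_pow]
  · rw [coe_integerMap, ← map_pow, hζ, map_one]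

/-- A `d`-th root of `p` in `L` cannot be fixed by all automorphisms that fix `ζ`, that is, `K(ζ)`
contains no such root. If `y` were such a root, then
`N * |T| * y`, with `T` the stabilizer of `ζ`, would be a combination of the traces of the
`y * ζ ^ j`, which are divisible by `p`, and so `y` would be divisible by `p`. -/
theorem exists_galois_apply_ne {q d : ℕ} (hv : IsUnramifiedValuation K v p q)
    (hd : 1 < d) (hN : N.Coprime p) {ζ : L} (hζ : IsPrimitiveRoot ζ N) (hN0 : N ≠ 0)
    (hT : (Nat.card (MulAction.stabilizer (L ≃ₐ[K] L) ζ)).Coprime p) {y : L} (hy : y ^ d = p) :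
    ∃ g : L ≃ₐ[K] L, g ζ = ζ ∧ g y ≠ y := by
  by_contra! hfix
  classical
  have hζ1 : v ζ = 1 := map_eq_one_of_pow_eq_one v hN0 hζ.pow_eq_one
  have hy1 : v y < 1 := by
    refine (pow_lt_one_iff (n := d) (by omega)).1 ?_
    rw [← map_pow, hy]
    exact hv.map_p_lt_one
  set t : ℕ → L := fun j => ∑ g : L ≃ₐ[K] L, g (y * ζ ^ j) with ht
  have htp : ∀ j, v (t j) ≤ v p := by
    intro j
    have h1 : t j ∈ Set.range (algebraMap K L) := by
      rw [IsGalois.mem_range_algebraMap_iff_fixed]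
      intro g
      rw [ht, map_sum]
      exact Fintype.sum_equiv (Equiv.mulLeft g) _ _ fun h => rfl
    have h2 : v (t j) < 1 := by
      refine v.map_sum_lt one_ne_zero fun g _ => ?_
      rw [hv.map_galois, map_mul, map_pow, hζ1, one_pow, mul_one]
      exact hy1
    obtain ⟨x, hx⟩ := h1
    rw [← hx] at h2 ⊢
    exact hv.le_map_p x h2
  have hsum : ∑ j ∈ Finset.range N, (ζ⁻¹) ^ j * t j =
      (Nat.card (MulAction.stabilizer (L ≃ₐ[K] L) ζ) : L) * N * y := by
    have h1 : ∀ g : L ≃ₐ[K] L, ∑ j ∈ Finset.range N, (ζ⁻¹) ^ j * g (y * ζ ^ j) =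
        if g ζ = ζ then (N : L) * y else 0 := by
      intro g
      have h2 : ∀ j ∈ Finset.range N, (ζ⁻¹) ^ j * g (y * ζ ^ j) = (ζ⁻¹ * g ζ) ^ j * g y := by
        intro j _
        rw [map_mul, map_pow, mul_pow]
        ring
      rw [Finset.sum_congr rfl h2, ← Finset.sum_mul]
      split_ifs with hg
      · rw [hg, inv_mul_cancel₀ (hζ.ne_zero hN0), hfix g hg]
        simp
      · have h3 : ζ⁻¹ * g ζ ≠ 1 := by
          rw [ne_eq, inv_mul_eq_one₀ (hζ.ne_zero hN0), eq_comm]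
          exact hg
        have h4 : (ζ⁻¹ * g ζ) ^ N = 1 := by
          rw [mul_pow, inv_pow, ← map_pow, hζ.pow_eq_one, map_one, inv_one, one_mul]
        rw [geom_sum_eq h3, h4, sub_self, zero_div, zero_mul]
    simp_rw [ht, Finset.mul_sum]
    rw [Finset.sum_comm, Finset.sum_congr rfl fun g _ => h1 g, ← Finset.sum_filter,
      Finset.sum_const, nsmul_eq_mul, mul_assoc]
    congr 2
    rw [← Fintype.card_subtype, ← Nat.card_eq_fintype_card]
    rfl
  have hle : v y ≤ v p := by
    have h1 : v (∑ j ∈ Finset.range N, (ζ⁻¹) ^ j * t j) ≤ v p := by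
      refine v.map_sum_le fun j _ => ?_
      rw [map_mul, map_pow, map_inv₀, hζ1, inv_one, one_pow, one_mul]
      exact htp j
    rw [hsum, map_mul, map_mul, hv.map_natCast_eq_one hT, hv.map_natCast_eq_one hN, one_mul,
      one_mul] at h1
    exact h1
  have h1 : v p ≤ v p ^ d := by
    calc v p = v y ^ d := by rw [← map_pow, hy]
      _ ≤ v p ^ d := pow_le_pow_left' hle d
  have h2 : v p ^ d < v p := by
    have := pow_lt_pow_right_of_lt_one₀ (pos_iff_ne_zero.2 hv.map_p_ne_zero) hv.map_p_lt_one hd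
    rwa [pow_one] at this
  exact (h1.trans_lt h2).false

/-- Some automorphism fixes `ζ` and maps `π` to `ζ * π`. The automorphisms that fix `ζ` map `π` to
`ζ ^ a * π` for the `a` in a subgroup of `ℤ/dⁿ`. If this subgroup were proper, then all these `a`
would be divisible by `d`, and the `d`-th root `π ^ d ^ (n - 1)` of `p` would be fixed. -/
theorem exists_galois_tame {q d n : ℕ} (hv : IsUnramifiedValuation K v p q) (hd : d.Prime)
    (hdp : d.Coprime p) {ζ π : L} (hζ : IsPrimitiveRoot ζ (d ^ n)) (hπ : π ^ d ^ n = p)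
    (hgen : ∀ g : L ≃ₐ[K] L, g ζ = ζ → g π = π → g = 1) :
    ∃ g : L ≃ₐ[K] L, g ζ = ζ ∧ g π = ζ * π := by
  have hN0 : d ^ n ≠ 0 := pow_ne_zero _ hd.ne_zero
  have : NeZero (d ^ n) := ⟨hN0⟩
  have hπ0 : π ≠ 0 := by
    rintro rfl
    rw [zero_pow hN0] at hπ
    exact hv.map_p_ne_zero (by rw [← hπ, map_zero])
  have hexp : ∀ g : L ≃ₐ[K] L, ∃ a : ℕ, g π = ζ ^ a * π := by
    intro g
    have h1 : (g π / π) ^ d ^ n = 1 := by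
      rw [div_pow, ← map_pow, hπ, map_natCast, ← hπ, div_self (pow_ne_zero _ hπ0)]
    obtain ⟨a, -, ha⟩ := hζ.eq_pow_of_pow_eq_one h1
    exact ⟨a, by rw [ha, div_mul_cancel₀ _ hπ0]⟩
  rcases n with _ | n
  · rw [pow_zero, IsPrimitiveRoot.one_right_iff] at hζ
    exact ⟨1, rfl, by rw [hζ, one_mul]; rfl⟩
  by_cases hex : ∃ g : L ≃ₐ[K] L, g ζ = ζ ∧ ∃ a : ℕ, g π = ζ ^ a * π ∧ a.Coprime d
  · obtain ⟨g, hg, a, ha, had⟩ := hex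
    obtain ⟨b, -, hb⟩ := Nat.exists_mul_mod_eq_one_of_coprime (had.pow_right (n + 1))
      (Nat.one_lt_pow n.succ_ne_zero hd.one_lt)
    refine ⟨g ^ b, ?_, ?_⟩
    · have : ∀ k : ℕ, (g ^ k) ζ = ζ := fun k => by
        induction k with
        | zero => rfl
        | succ k ih => rw [pow_succ, AlgEquiv.mul_apply, hg, ih]
      exact this b
    · rw [pow_apply_of_fixed hg ha, ← pow_mod_orderOf, ← hζ.eq_orderOf, hb, pow_one]
  · exfalso
    push Not at hex
    have hcard : (Nat.card (MulAction.stabilizer (L ≃ₐ[K] L) ζ)).Coprime p := by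
      have : Fact d.Prime := ⟨hd⟩
      have hpg : IsPGroup d (MulAction.stabilizer (L ≃ₐ[K] L) ζ) := by
        rintro ⟨g, hg⟩
        refine ⟨n + 1, Subtype.ext ?_⟩
        obtain ⟨a, ha⟩ := hexp g
        refine hgen _ (pow_mem hg (d ^ (n + 1))) ?_
        change (g ^ d ^ (n + 1)) π = π
        rw [pow_apply_of_fixed hg ha, mul_comm a, pow_mul, hζ.pow_eq_one, one_pow, one_mul]
      obtain ⟨k, hk⟩ := IsPGroup.iff_card.1 hpg
      rw [hk]
      exact hdp.pow_left k
    obtain ⟨g, hg, hgy⟩ := hv.exists_galois_apply_ne hd.one_lt (hdp.pow_left (n + 1)) hζ hN0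
      hcard (y := π ^ d ^ n) (by rw [← pow_mul, ← pow_succ, hπ])
    obtain ⟨a, ha⟩ := hexp g
    have hda : d ∣ a := by
      by_contra hda
      exact hex g hg a ha ((hd.coprime_iff_not_dvd.2 hda).symm)
    obtain ⟨c, rfl⟩ := hda
    apply hgy
    rw [map_pow, ha, mul_pow, ← pow_mul, mul_right_comm, ← pow_succ', pow_mul, hζ.pow_eq_one,
      one_pow, one_mul]

end IsUnramifiedValuation

end Galois

/-! ### The levels of the tree as radicals of `p` -/

section Levels

/-- The polynomial `(X + p) ^ d - p`, conjugate to `X ^ d` through the translation by `p`. -/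
noncomputable def shiftedPower (K : Type*) [Field K] (p d : ℕ) : K[X] :=
  (X + C (p : K)) ^ d - C (p : K)

variable {K : Type*} [Field K] {p d : ℕ}

theorem aeval_shiftedPower (x : SeparableClosure K) :
    aeval x (shiftedPower K p d) = (x + p) ^ d - p := by
  simp [shiftedPower]

theorem iterate_shiftedPower (n : ℕ) (x : SeparableClosure K) :
    (fun y : SeparableClosure K => aeval y (shiftedPower K p d))^[n] x = (x + p) ^ d ^ n - p := by
  induction n generalizing x with
  | zero => simp
  | succ n ih =>
    rw [Function.iterate_succ_apply, ih, aeval_shiftedPower, sub_add_cancel, ← pow_mul, pow_succ']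

theorem mem_levelSet_shiftedPower {n : ℕ} {x : SeparableClosure K} :
    x ∈ levelSet (shiftedPower K p d) 0 n ↔ (x + p) ^ d ^ n = p := by
  rw [levelSet, Set.mem_ofPred_eq, iterate_shiftedPower, map_zero, sub_eq_zero]

/-- Compatible systems `ζ_n` of primitive roots of unity of order `dⁿ` and `π_n` of `dⁿ`-th roots
of `p`. -/
structure RootSystem (K : Type*) [Field K] (p d : ℕ) where
  zeta : ℕ → SeparableClosure K
  pi : ℕ → SeparableClosure K
  isPrimitiveRoot n : IsPrimitiveRoot (zeta n) (d ^ n)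
  zeta_succ_pow n : zeta (n + 1) ^ d = zeta n
  pi_zero : pi 0 = p
  pi_succ_pow n : pi (n + 1) ^ d = pi n

theorem exists_compatible_seq {Ω : Type*} [Monoid Ω] (d : ℕ) (P : ℕ → Ω → Prop) {a : Ω} (h0 : P 0 a)
    (hstep : ∀ n x, P n x → ∃ y, P (n + 1) y ∧ y ^ d = x) :
    ∃ s : ℕ → Ω, s 0 = a ∧ (∀ n, P n (s n)) ∧ ∀ n, s (n + 1) ^ d = s n := by
  choose next hnext using fun n (x : {x // P n x}) => hstep n x.1 x.2
  let s : ∀ n, {x // P n x} := fun n =>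
    Nat.rec ⟨a, h0⟩ (fun n x => ⟨next n x, (hnext n x).1⟩) n
  exact ⟨fun n => (s n).1, rfl, fun n => (s n).2, fun n => (hnext n (s n)).2⟩

/-- For `n = 0` not every `d`-th root `y` of `x = 1` is primitive; for `n > 0` every `y` is. -/
theorem exists_isPrimitiveRoot_pow_eq {Ω : Type*} [Field Ω] [IsAlgClosed Ω] [CharZero Ω]
    (hd : d.Prime) (n : ℕ) (x : Ω) (hx : IsPrimitiveRoot x (d ^ n)) :
    ∃ y : Ω, IsPrimitiveRoot y (d ^ (n + 1)) ∧ y ^ d = x := by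
  rcases n with _ | n
  · have : NeZero (d : Ω) := ⟨by exact_mod_cast hd.ne_zero⟩
    rw [pow_zero, IsPrimitiveRoot.one_right_iff] at hx
    obtain ⟨y, hy⟩ := HasEnoughRootsOfUnity.exists_primitiveRoot Ω d
    exact ⟨y, by simpa using hy, by rw [hx, hy.pow_eq_one]⟩
  · obtain ⟨y, hy⟩ := IsAlgClosed.exists_pow_nat_eq x hd.pos
    refine ⟨y, ?_, hy⟩
    have : Fact d.Prime := ⟨hd⟩
    rw [IsPrimitiveRoot.iff_orderOf]
    refine orderOf_eq_prime_pow ?_ ?_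
    · rw [pow_succ', pow_mul, hy]
      exact hx.pow_ne_one_of_pos_of_lt (pow_ne_zero _ hd.ne_zero)
        (Nat.pow_lt_pow_right hd.one_lt n.lt_succ_self)
    · rw [pow_succ', pow_mul, hy, hx.pow_eq_one]

theorem nonempty_rootSystem [CharZero K] (p : ℕ) (hd : d.Prime) : Nonempty (RootSystem K p d) := by
  have : IsAlgClosed (SeparableClosure K) := inferInstance
  have : CharZero (SeparableClosure K) :=
    charZero_of_injective_algebraMap (algebraMap K (SeparableClosure K)).injective
  obtain ⟨ζ, -, hζ, hζ'⟩ := exists_compatible_seq d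
    (fun n (x : SeparableClosure K) => IsPrimitiveRoot x (d ^ n)) (a := 1) (by simp)
    (exists_isPrimitiveRoot_pow_eq hd)
  obtain ⟨π, hπ, -, hπ'⟩ := exists_compatible_seq d
    (fun _ (_ : SeparableClosure K) => True) (a := (p : SeparableClosure K)) trivial
    (fun n x _ => (IsAlgClosed.exists_pow_nat_eq x hd.pos).imp fun y hy => ⟨trivial, hy⟩)
  exact ⟨⟨ζ, π, hζ, hζ', hπ, hπ'⟩⟩

namespace RootSystem

variable (R : RootSystem K p d)

theorem pi_pow (n : ℕ) : R.pi n ^ d ^ n = p := by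
  induction n with
  | zero => simpa using R.pi_zero
  | succ n ih => rw [pow_succ', pow_mul, R.pi_succ_pow, ih]

theorem zeta_pow_mod (n a : ℕ) : R.zeta n ^ (a % d ^ n) = R.zeta n ^ a := by
  rw [(R.isPrimitiveRoot n).eq_orderOf, pow_mod_orderOf]

/-- The vertex `ζ_n ^ i * π_n - p` with index `i ∈ ℤ/dⁿ`. -/
noncomputable def vertex (n : ℕ) (i : ZMod (d ^ n)) : Level (shiftedPower K p d) 0 n :=
  ⟨R.zeta n ^ i.val * R.pi n - p, by
    rw [mem_levelSet_shiftedPower, sub_add_cancel, mul_pow, ← pow_mul, mul_comm i.val, pow_mul,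
      (R.isPrimitiveRoot n).pow_eq_one, one_pow, one_mul, R.pi_pow]⟩

theorem vertex_natCast (n a : ℕ) :
    (R.vertex n (a : ZMod (d ^ n))).val = R.zeta n ^ a * R.pi n - p := by
  rw [← R.zeta_pow_mod n a, ← ZMod.val_natCast]
  rfl

variable [CharZero K] [Fact p.Prime] [Fact d.Prime]

theorem pi_ne_zero (n : ℕ) : R.pi n ≠ 0 := by
  intro h
  have h1 := R.pi_pow n
  have : CharZero (SeparableClosure K) :=
    charZero_of_injective_algebraMap (algebraMap K (SeparableClosure K)).injective
  rw [h, zero_pow (pow_ne_zero _ (Fact.out : d.Prime).ne_zero)] at h1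
  exact (Fact.out : p.Prime).ne_zero (by exact_mod_cast h1.symm)

theorem vertex_bijective (n : ℕ) : Function.Bijective (R.vertex n) := by
  constructor
  · intro i j hij
    have h1 : R.zeta n ^ i.val * R.pi n - p = R.zeta n ^ j.val * R.pi n - p :=
      congrArg Level.val hij
    exact ZMod.val_injective _ ((R.isPrimitiveRoot n).pow_inj (ZMod.val_lt i) (ZMod.val_lt j)
      (mul_right_cancel₀ (R.pi_ne_zero n) (sub_left_inj.1 h1)))
  · rintro ⟨x, hx⟩
    have h1 : ((x + p) / R.pi n) ^ d ^ n = 1 := by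
      rw [div_pow, mem_levelSet_shiftedPower.1 hx, ← R.pi_pow n,
        div_self (pow_ne_zero _ (R.pi_ne_zero n))]
    obtain ⟨a, -, ha⟩ := (R.isPrimitiveRoot n).eq_pow_of_pow_eq_one h1
    refine ⟨a, Subtype.ext ((R.vertex_natCast n a).trans ?_)⟩
    rw [ha, div_mul_cancel₀ _ (R.pi_ne_zero n), add_sub_cancel_right]

/-- The labelling of the vertices of level `n` by `ℤ/dⁿ`. -/
noncomputable def levelEquiv (n : ℕ) : ZMod (d ^ n) ≃ Level (shiftedPower K p d) 0 n :=
  Equiv.ofBijective (R.vertex n) (R.vertex_bijective n)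

theorem levelEquiv_natCast (n a : ℕ) :
    (R.levelEquiv n (a : ZMod (d ^ n))).val = R.zeta n ^ a * R.pi n - p :=
  R.vertex_natCast n a

theorem parent_levelEquiv (n : ℕ) (i : ZMod (d ^ (n + 1))) :
    parent (R.levelEquiv (n + 1) i) =
      R.levelEquiv n (ZMod.castHom (pow_dvd_pow d n.le_succ) (ZMod (d ^ n)) i) := by
  obtain ⟨a, rfl⟩ := ZMod.natCast_zmod_surjective i
  rw [map_natCast (ZMod.castHom _ _)]
  refine Subtype.ext ?_
  change aeval (R.levelEquiv (n + 1) a).val (shiftedPower K p d) = (R.levelEquiv n a).val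
  rw [aeval_shiftedPower, levelEquiv_natCast, levelEquiv_natCast, sub_add_cancel, mul_pow,
    R.pi_succ_pow, ← pow_mul, mul_comm a, pow_mul, R.zeta_succ_pow]

/-- The action of `BS(1,q)` on the tree that is affine in the labels of the vertices. -/
noncomputable def treeAction {q : ℕ} (h : ∀ n, q.Coprime (d ^ n)) :
    BS q →* TreeAut (shiftedPower K p d) 0 :=
  (MonoidHom.pi fun n =>
    (R.levelEquiv n).permCongrHom.toMonoidHom.comp (affineAction (h n))).codRestrict _ (by
      intro g n b
      obtain ⟨i, rfl⟩ := (R.levelEquiv (n + 1)).surjective b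
      change parent (R.levelEquiv (n + 1) (affineAction (h (n + 1)) g
        ((R.levelEquiv (n + 1)).symm (R.levelEquiv (n + 1) i)))) =
        R.levelEquiv n (affineAction (h n) g
          ((R.levelEquiv n).symm (parent (R.levelEquiv (n + 1) i))))
      rw [parent_levelEquiv, parent_levelEquiv, Equiv.symm_apply_apply, Equiv.symm_apply_apply,
        affineAction_castHom (h (n + 1)) (h n)])

theorem actLevel_treeAction {q : ℕ} (h : ∀ n, q.Coprime (d ^ n)) (g : BS q) (n : ℕ)
    (i : ZMod (d ^ n)) :
    actLevel (R.treeAction h g) n (R.levelEquiv n i) =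
      R.levelEquiv n (affineAction (h n) g i) := by
  change R.levelEquiv n (affineAction (h n) g ((R.levelEquiv n).symm (R.levelEquiv n i))) = _
  rw [Equiv.symm_apply_apply]

/-- The path of the vertices `π_n - p`. -/
noncomputable def basePath : Path (shiftedPower K p d) 0 :=
  ⟨fun n => R.levelEquiv n 0, fun n => by rw [parent_levelEquiv, map_zero]⟩

theorem vertexStabilizer_treeAction {q : ℕ} (hd : 0 < d) (h : ∀ n, q.Coprime (d ^ n)) (n : ℕ) :
    (affineChain hd h).grp n = vertexStabilizer (R.treeAction h) (R.basePath.vertex n) := by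
  ext g
  rw [mem_affineChain_grp]
  change _ ↔ actLevel (R.treeAction h g) n (R.levelEquiv n 0) = R.levelEquiv n 0
  rw [actLevel_treeAction, EmbeddingLike.apply_eq_iff_eq]

end RootSystem

end Levels

/-! ### The Galois action on the levels -/

section GaloisLevels

variable {K : Type*} [Field K] {p d : ℕ}

theorem Level.val_injective {f : K[X]} {α : K} {n : ℕ} :
    Function.Injective (Level.val : Level f α n → SeparableClosure K) :=
  fun _ _ h => Subtype.ext h

theorem Level.toLevelField_injective {f : K[X]} {α : K} {n : ℕ} :
    Function.Injective (Level.toLevelField : Level f α n → levelField f α n) :=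
  fun _ _ h =>
    Level.val_injective (congrArg (fun y : levelField f α n => (y : SeparableClosure K)) h)

/-- The action of the Galois group of `K(f⁻ⁿ(0))` on the level `n`. -/
noncomputable def levelPerm (n : ℕ) :
    (levelField (shiftedPower K p d) 0 n ≃ₐ[K] levelField (shiftedPower K p d) 0 n) →*
      Equiv.Perm (Level (shiftedPower K p d) 0 n) :=
  have hmem : ∀ (g : levelField (shiftedPower K p d) 0 n ≃ₐ[K] levelField (shiftedPower K p d) 0 n)
      (x : Level (shiftedPower K p d) 0 n),
      (g x.toLevelField : SeparableClosure K) ∈ levelSet (shiftedPower K p d) 0 n := by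
    intro g x
    have h1 : (x.toLevelField + (p : levelField (shiftedPower K p d) 0 n)) ^ d ^ n = p :=
      Subtype.ext (mem_levelSet_shiftedPower.1 x.2)
    have h2 := congrArg Subtype.val (congrArg g h1)
    rw [mem_levelSet_shiftedPower]
    simpa using h2
  { toFun g :=
      { toFun := fun x => ⟨g x.toLevelField, hmem g x⟩
        invFun := fun x => ⟨g⁻¹ x.toLevelField, hmem g⁻¹ x⟩
        left_inv := fun x => Level.toLevelField_injective (g.symm_apply_apply x.toLevelField)
        right_inv := fun x =>
          Level.toLevelField_injective (g.apply_symm_apply x.toLevelField) }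
    map_one' := rfl
    map_mul' _ _ := rfl }

theorem toLevelField_levelPerm {n : ℕ}
    (g : levelField (shiftedPower K p d) 0 n ≃ₐ[K] levelField (shiftedPower K p d) 0 n)
    (x : Level (shiftedPower K p d) 0 n) :
    (levelPerm n g x).toLevelField = g x.toLevelField := rfl

theorem levelPerm_injective (n : ℕ) : Function.Injective (levelPerm (K := K) (p := p) (d := d) n) := by
  intro g h hgh
  have : (g : levelField (shiftedPower K p d) 0 n →ₐ[K] levelField (shiftedPower K p d) 0 n) = h :=
    IntermediateField.adjoin_algHom_ext K fun x hx =>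
      congrArg Level.toLevelField (Equiv.congr_fun hgh ⟨x, hx⟩)
  exact AlgEquiv.ext fun x => DFunLike.congr_fun this x

instance levelField_normal (f : K[X]) (α : K) (n : ℕ) : Normal K (levelField f α n) := by
  rw [IntermediateField.normal_iff_forall_map_le']
  intro g
  rw [IntermediateField.map_le_iff_le_comap, IntermediateField.adjoin_le_iff]
  exact fun x hx => IntermediateField.subset_adjoin K _ (galois_mem_levelSet g hx)

/-- Restriction to `K(f⁻ⁿ(0))` is compatible with the actions on the level `n`. -/
theorem levelPerm_restrictNormalHom (n : ℕ) (g : SeparableClosure K ≃ₐ[K] SeparableClosure K)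
    (x : Level (shiftedPower K p d) 0 n) :
    levelPerm n (AlgEquiv.restrictNormalHom (levelField (shiftedPower K p d) 0 n) g) x =
      actLevel (arborealRep (shiftedPower K p d) 0 g) n x :=
  Subtype.ext (AlgEquiv.restrictNormal_commutes g (levelField (shiftedPower K p d) 0 n)
    x.toLevelField)

variable [CharZero K] [Fact p.Prime] [Fact d.Prime]

namespace RootSystem

theorem card_level (R : RootSystem K p d) (n : ℕ) : Nat.card (Level (shiftedPower K p d) 0 n) = d ^ n := by
  rw [← Nat.card_congr (R.levelEquiv n), Nat.card_zmod]

theorem finiteDimensional_levelField (R : RootSystem K p d) (n : ℕ) :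
    FiniteDimensional K (levelField (shiftedPower K p d) 0 n) := by
  have : NeZero (d ^ n) := ⟨pow_ne_zero _ (Fact.out : d.Prime).ne_zero⟩
  have : Finite (levelSet (shiftedPower K p d) 0 n) := Finite.of_equiv _ (R.levelEquiv n)
  exact IntermediateField.finiteDimensional_adjoin fun x _ => Algebra.IsIntegral.isIntegral x

variable (R : RootSystem K p d)

theorem pi_mem_levelField (n : ℕ) : R.pi n ∈ levelField (shiftedPower K p d) 0 n := by
  have h1 : R.pi n = (R.levelEquiv n ((0 : ℕ) : ZMod (d ^ n))).val + p := by
    rw [levelEquiv_natCast, sub_add_cancel, pow_zero, one_mul]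
  rw [h1]
  exact add_mem (Level.toLevelField (R.levelEquiv n _)).2 (natCast_mem _ _)

theorem zeta_mem_levelField (n : ℕ) : R.zeta n ∈ levelField (shiftedPower K p d) 0 n := by
  have h1 : R.zeta n = ((R.levelEquiv n ((1 : ℕ) : ZMod (d ^ n))).val + p) / R.pi n := by
    rw [levelEquiv_natCast, sub_add_cancel, pow_one, mul_div_cancel_right₀ _ (R.pi_ne_zero n)]
  rw [h1]
  exact div_mem (add_mem (Level.toLevelField (R.levelEquiv n _)).2 (natCast_mem _ _)) (R.pi_mem_levelField n)

/-- The root of unity `ζ_n` as an element of `K(f⁻ⁿ(0))`. -/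
noncomputable def zeta' (n : ℕ) : levelField (shiftedPower K p d) 0 n :=
  ⟨R.zeta n, R.zeta_mem_levelField n⟩

/-- The radical `π_n` as an element of `K(f⁻ⁿ(0))`. -/
noncomputable def pi' (n : ℕ) : levelField (shiftedPower K p d) 0 n :=
  ⟨R.pi n, R.pi_mem_levelField n⟩

theorem isPrimitiveRoot_zeta' (n : ℕ) : IsPrimitiveRoot (R.zeta' n) (d ^ n) :=
  IsPrimitiveRoot.of_map_of_injective
    (f := algebraMap (levelField (shiftedPower K p d) 0 n) (SeparableClosure K))
    (R.isPrimitiveRoot n)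
    (algebraMap (levelField (shiftedPower K p d) 0 n) (SeparableClosure K)).injective

theorem pi'_pow (n : ℕ) : R.pi' n ^ d ^ n = p := Subtype.ext (R.pi_pow n)

theorem toLevelField_levelEquiv (n a : ℕ) :
    (R.levelEquiv n (a : ZMod (d ^ n))).toLevelField = R.zeta' n ^ a * R.pi' n - p :=
  Subtype.ext (R.levelEquiv_natCast n a)

/-- In the labels of the vertices, the Galois group acts by affine maps. -/
theorem levelPerm_levelEquiv {n a u : ℕ}
    {g : levelField (shiftedPower K p d) 0 n ≃ₐ[K] levelField (shiftedPower K p d) 0 n}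
    (hζ : g (R.zeta' n) = R.zeta' n ^ u) (hπ : g (R.pi' n) = R.zeta' n ^ a * R.pi' n)
    (i : ZMod (d ^ n)) :
    levelPerm n g (R.levelEquiv n i) = R.levelEquiv n (u * i + a) := by
  obtain ⟨b, rfl⟩ := ZMod.natCast_zmod_surjective i
  have h1 : (u * b + a : ZMod (d ^ n)) = ((u * b + a : ℕ) : ZMod (d ^ n)) := by push_cast; rfl
  apply Level.toLevelField_injective
  rw [h1, toLevelField_levelPerm, toLevelField_levelEquiv, toLevelField_levelEquiv, map_sub,
    map_mul, map_pow, hζ, hπ, map_natCast]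
  ring

theorem exists_apply_pi' (n : ℕ)
    (g : levelField (shiftedPower K p d) 0 n ≃ₐ[K] levelField (shiftedPower K p d) 0 n) :
    ∃ a : ℕ, g (R.pi' n) = R.zeta' n ^ a * R.pi' n := by
  have hd0 := pow_ne_zero n (Fact.out : d.Prime).ne_zero
  have : NeZero (d ^ n) := ⟨hd0⟩
  have h0 : R.pi' n ≠ 0 := fun h => R.pi_ne_zero n (congrArg Subtype.val h)
  have h1 : (g (R.pi' n) / R.pi' n) ^ d ^ n = 1 := by
    rw [div_pow, ← map_pow, R.pi'_pow, map_natCast, ← R.pi'_pow n, div_self (pow_ne_zero _ h0)]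
  obtain ⟨a, -, ha⟩ := (R.isPrimitiveRoot_zeta' n).eq_pow_of_pow_eq_one h1
  exact ⟨a, by rw [ha, div_mul_cancel₀ _ h0]⟩

theorem eq_one_of_fixed {n : ℕ}
    {g : levelField (shiftedPower K p d) 0 n ≃ₐ[K] levelField (shiftedPower K p d) 0 n}
    (hζ : g (R.zeta' n) = R.zeta' n) (hπ : g (R.pi' n) = R.pi' n) : g = 1 := by
  apply levelPerm_injective n
  refine Equiv.ext fun x => ?_
  obtain ⟨i, rfl⟩ := (R.levelEquiv n).surjective x
  rw [R.levelPerm_levelEquiv (u := 1) (a := 0) (by rw [pow_one, hζ]) (by rw [pow_zero, one_mul, hπ])]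
  simp

end RootSystem

/-- The Galois group of `K(f⁻ⁿ(0))` and `BS(1,q)` act on the level `n` through the same group of
permutations. -/
theorem RootSystem.range_levelPerm (R : RootSystem K p d) [Algebra ℚ_[p] K] [Algebra ℤ_[p] K]
    [IsScalarTower ℤ_[p] ℚ_[p] K] [FiniteDimensional ℚ_[p] K] {m : ℕ}
    (hK : IsUnramifiedOfDegree p K m) (hdp : d.Coprime p) (n : ℕ)
    (h : (p ^ m).Coprime (d ^ n)) :
    (levelPerm (K := K) (p := p) (d := d) n).range =
      ((R.levelEquiv n).permCongrHom.toMonoidHom.comp (affineAction h)).range := by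
  have hp : p.Prime := Fact.out
  have hd : d.Prime := Fact.out
  have := R.finiteDimensional_levelField n
  set L := levelField (shiftedPower K p d) 0 n
  have : Normal K L := levelField_normal _ _ _
  have : IsGalois K L := { }
  let : Algebra ℚ_[p] L := ((algebraMap K L).comp (algebraMap ℚ_[p] K)).toAlgebra
  have : IsScalarTower ℚ_[p] K L := IsScalarTower.of_algebraMap_eq' rfl
  have : Algebra.IsAlgebraic ℚ_[p] L := Algebra.IsAlgebraic.trans ℚ_[p] K L
  have hv : IsUnramifiedValuation K (padicExtension p L) p (p ^ m) :=
    isUnramifiedValuation_padicExtension p hK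
  have hN0 : d ^ n ≠ 0 := pow_ne_zero _ hd.ne_zero
  have hN : (d ^ n).Coprime p := hdp.pow_left n
  set A := (R.levelEquiv n).permCongrHom.toMonoidHom.comp (affineAction h) with hA
  have hAapply : ∀ b i, A b (R.levelEquiv n i) = R.levelEquiv n (affineAction h b i) := by
    intro b i
    change R.levelEquiv n (affineAction h b ((R.levelEquiv n).symm (R.levelEquiv n i))) = _
    rw [Equiv.symm_apply_apply]
  have hag : ∀ (g : L ≃ₐ[K] L) (a k : ℕ), g (R.zeta' n) = R.zeta' n ^ (p ^ m) ^ k →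
      g (R.pi' n) = R.zeta' n ^ a * R.pi' n →
      levelPerm n g = A (BS.tau (p ^ m) ^ (a : ℤ) * BS.sigma (p ^ m) ^ k) := by
    intro g a k hζ hπ
    refine Equiv.ext fun x => ?_
    obtain ⟨i, rfl⟩ := (R.levelEquiv n).surjective x
    rw [R.levelPerm_levelEquiv hζ hπ, hAapply, map_mul, Equiv.Perm.mul_apply,
      affineAction_sigma_pow, affineAction_tau_zpow]
    push_cast
    rfl
  apply le_antisymm
  · rintro _ ⟨g, rfl⟩
    obtain ⟨k, hk⟩ := hv.exists_galois_eq_pow hp hN0 hN (R.isPrimitiveRoot_zeta' n).pow_eq_one g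
    obtain ⟨a, ha⟩ := R.exists_apply_pi' n g
    exact ⟨_, (hag g a k hk ha).symm⟩
  · have htau : A (BS.tau (p ^ m)) ∈ (levelPerm (K := K) (p := p) (d := d) n).range := by
      obtain ⟨g, hζ, hπ⟩ := hv.exists_galois_tame hd hdp (R.isPrimitiveRoot_zeta' n) (R.pi'_pow n)
        fun g h1 h2 => R.eq_one_of_fixed h1 h2
      refine ⟨g, ?_⟩
      rw [hag g 1 0 (by rw [pow_zero, pow_one, hζ]) (by rw [pow_one, hπ])]
      simp
    have hsigma : A (BS.sigma (p ^ m)) ∈ (levelPerm (K := K) (p := p) (d := d) n).range := by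
      obtain ⟨g, hζ⟩ := hv.exists_galois_frobenius hp hN0 hN
        (R.isPrimitiveRoot_zeta' n).pow_eq_one
      obtain ⟨a, ha⟩ := R.exists_apply_pi' n g
      have h1 := hag g a 1 (by rw [pow_one, hζ]) ha
      rw [map_mul, pow_one, map_zpow, ← inv_mul_eq_iff_eq_mul] at h1
      rw [← h1]
      exact mul_mem (inv_mem (zpow_mem htau _)) ⟨g, rfl⟩
    rw [MonoidHom.range_eq_map, ← BS.closure_tau_sigma, MonoidHom.map_closure,
      Subgroup.closure_le]
    rintro _ ⟨x, rfl | rfl, rfl⟩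
    exacts [htau, hsigma]

/-- The Galois group of `K(f⁻ⁿ(0))` and the metacyclic group both act faithfully on the level `n`, and
the images of the two actions agree. -/
theorem RootSystem.exists_mulEquiv (R : RootSystem K p d) [Algebra ℚ_[p] K] [Algebra ℤ_[p] K]
    [IsScalarTower ℤ_[p] ℚ_[p] K] [FiniteDimensional ℚ_[p] K] {m : ℕ}
    (hK : IsUnramifiedOfDegree p K m) (hdp : d.Coprime p) (h : ∀ n, (p ^ m).Coprime (d ^ n))
    (n : ℕ) :
    ∃ e : Metacyclic (p ^ m) (d ^ n) (orderOf ((p ^ m : ℕ) : ZMod (d ^ n))) ≃*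
        (levelField (shiftedPower K p d) 0 n ≃ₐ[K] levelField (shiftedPower K p d) 0 n),
      ∀ (g : BS (p ^ m)) (x : Level (shiftedPower K p d) 0 n),
        e (BS.toMetacyclic (p ^ m) (d ^ n) _ g) x.toLevelField =
          (actLevel (R.treeAction h g) n x).toLevelField := by
  have : NeZero (d ^ n) := ⟨pow_ne_zero _ (Fact.out : d.Prime).ne_zero⟩
  set B := (R.levelEquiv n).permCongrHom.toMonoidHom.comp (metacyclicAction (h n)) with hB
  have hBinj : Function.Injective B :=
    (R.levelEquiv n).permCongrHom.injective.comp (metacyclicAction_injective (h n))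
  have hBA : B.comp (BS.toMetacyclic (p ^ m) (d ^ n) _) =
      (R.levelEquiv n).permCongrHom.toMonoidHom.comp (affineAction (h n)) :=
    MonoidHom.ext fun g => congrArg (R.levelEquiv n).permCongrHom
      (metacyclicAction_toMetacyclic (h n) g)
  have hrange : B.range = (levelPerm (K := K) (p := p) (d := d) n).range := by
    rw [R.range_levelPerm hK hdp n (h n), ← hBA, MonoidHom.range_comp B,
      MonoidHom.range_eq_top.2 (BS.toMetacyclic_surjective _ _ _), ← MonoidHom.range_eq_map]
  let e := (B.ofInjective hBinj).trans ((MulEquiv.subgroupCongr hrange).trans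
    ((levelPerm (K := K) (p := p) (d := d) n).ofInjective (levelPerm_injective n)).symm)
  have he : ∀ y, levelPerm n (e y) = B y := fun y =>
    congrArg Subtype.val (((levelPerm (K := K) (p := p) (d := d) n).ofInjective
      (levelPerm_injective n)).apply_symm_apply
        (MulEquiv.subgroupCongr hrange (B.ofInjective hBinj y)))
  refine ⟨e, fun g x => ?_⟩
  rw [← toLevelField_levelPerm, he]
  exact congrArg (fun F => Level.toLevelField (F x)) (DFunLike.congr_fun hBA g)

end GaloisLevels

/-! ### The Ellis group -/

section Ellis

open Filter Topology

variable {K : Type*} [Field K] {f : K[X]} {α : K}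

instance (n : ℕ) : DiscreteTopology (Level f α n) := ⟨rfl⟩

instance : T2Space (Path f α) :=
  inferInstanceAs (T2Space {v : ∀ n, Level f α n // ∀ n, parent (v (n + 1)) = v n})

theorem continuous_path_iff {X : Type*} [TopologicalSpace X] {F : X → Path f α} :
    Continuous F ↔ ∀ n, Continuous fun x => (F x).vertex n :=
  continuous_induced_rng.trans continuous_pi_iff

theorem tendsto_path_iff {ι : Type*} {l : Filter ι} {F : ι → Path f α} {v : Path f α} :
    Tendsto F l (𝓝 v) ↔ ∀ n, ∀ᶠ i in l, (F i).vertex n = v.vertex n := by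
  have h1 : Tendsto F l (𝓝 v) ↔ Tendsto (fun i => (F i).1) l (𝓝 v.1) :=
    Topology.IsInducing.subtypeVal.tendsto_nhds_iff
  rw [h1, tendsto_pi_nhds]
  refine forall_congr' fun n => ?_
  rw [nhds_discrete, tendsto_pure]
  rfl

theorem Path.vertex_eq_of_le {v w : Path f α} {k n : ℕ} (hkn : k ≤ n)
    (h : v.vertex n = w.vertex n) : v.vertex k = w.vertex k := by
  induction hkn with
  | refl => exact h
  | step _ ih => exact ih ((v.2 _).symm.trans ((congrArg parent h).trans (w.2 _)))

/-- Automorphisms that are approximated on every level by automorphisms from a set are limits of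
these as maps of the path space. -/
theorem actPath_mem_closure {ι : Type*} (b : ι → TreeAut f α) (a : TreeAut f α)
    (h : ∀ n, ∃ i, ∀ x, actLevel (b i) n x = actLevel a n x) :
    actPath a ∈ closure (Set.range fun i => actPath (b i)) := by
  choose i hi using h
  refine mem_closure_of_tendsto (f := fun n => actPath (b (i n))) (b := atTop) ?_
    (Eventually.of_forall fun n => ⟨i n, rfl⟩)
  rw [tendsto_pi_nhds]
  intro v
  rw [tendsto_path_iff]
  intro k
  filter_upwards [eventually_ge_atTop k] with n hn
  exact Path.vertex_eq_of_le hn (hi n _)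

/-- The image of the arboreal representation is closed, as a continuous image of the absolute Galois
group, which is compact. -/
theorem isClosed_arborealImage (f : K[X]) (α : K) : IsClosed (arborealImage f α) := by
  have hcont : Continuous fun g => actPath (arborealRep f α g) := by
    refine continuous_pi fun v => continuous_path_iff.2 fun n => ?_
    rw [continuous_discrete_rng]
    intro y
    rw [isOpen_iff_mem_nhds]
    intro g hg
    have hopen := stabilizer_isOpen_of_isIntegral (K := K) (v.vertex n).val
    have h1 : (fun h : SeparableClosure K ≃ₐ[K] SeparableClosure K => g⁻¹ * h) ⁻¹'
        (MulAction.stabilizer (SeparableClosure K ≃ₐ[K] SeparableClosure K) (v.vertex n).val) ∈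
        𝓝 g := by
      refine (hopen.preimage (continuous_const_mul g⁻¹)).mem_nhds ?_
      simp
    filter_upwards [h1] with h hh
    have h2 : (g⁻¹ * h) (v.vertex n).val = (v.vertex n).val := hh
    have h3 : h (v.vertex n).val = g (v.vertex n).val := by
      conv_rhs => rw [← h2]
      rw [← AlgEquiv.mul_apply, mul_inv_cancel_left]
    rw [Set.mem_preimage, Set.mem_singleton_iff] at hg ⊢
    rw [← hg]
    exact Level.val_injective h3
  exact (isCompact_range hcont).isClosed

/-- A group that acts on every level through the same permutations as the absolute Galois group
has the image of the arboreal representation as its Ellis semigroup. -/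
theorem ellisSemigroup_eq_arborealImage {G : Type*} [Group G] (Φ : G →* TreeAut f α)
    (h1 : ∀ g n, ∃ b, ∀ x, actLevel (Φ b) n x = actLevel (arborealRep f α g) n x)
    (h2 : ∀ b n, ∃ g, ∀ x, actLevel (arborealRep f α g) n x = actLevel (Φ b) n x) :
    ellisSemigroup Φ = arborealImage f α := by
  apply le_antisymm
  · refine closure_minimal ?_ (isClosed_arborealImage f α)
    rintro _ ⟨b, rfl⟩
    rw [← (isClosed_arborealImage f α).closure_eq]
    exact actPath_mem_closure (fun g => arborealRep f α g) _ (h2 b)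
  · rintro _ ⟨g, rfl⟩
    exact actPath_mem_closure (fun b => Φ b) _ (h1 g)

variable {p d : ℕ} [CharZero K] [Fact p.Prime] [Fact d.Prime]

theorem RootSystem.ellisSemigroup_treeAction (R : RootSystem K p d) [Algebra ℚ_[p] K]
    [Algebra ℤ_[p] K] [IsScalarTower ℤ_[p] ℚ_[p] K] [FiniteDimensional ℚ_[p] K] {m : ℕ}
    (hK : IsUnramifiedOfDegree p K m) (hdp : d.Coprime p) (h : ∀ n, (p ^ m).Coprime (d ^ n)) :
    ellisSemigroup (R.treeAction h) = arborealImage (shiftedPower K p d) 0 := by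
  refine ellisSemigroup_eq_arborealImage _ (fun g n => ?_) fun b n => ?_
  · have h1 : levelPerm n (AlgEquiv.restrictNormalHom (levelField (shiftedPower K p d) 0 n) g) ∈
        (levelPerm (K := K) (p := p) (d := d) n).range := ⟨_, rfl⟩
    rw [R.range_levelPerm hK hdp n (h n)] at h1
    obtain ⟨b, hb⟩ := h1
    exact ⟨b, fun x => (Equiv.congr_fun hb x).trans (levelPerm_restrictNormalHom n g x)⟩
  · have h1 : (R.levelEquiv n).permCongrHom.toMonoidHom.comp (affineAction (h n)) b ∈
        ((R.levelEquiv n).permCongrHom.toMonoidHom.comp (affineAction (h n))).range := ⟨b, rfl⟩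
    rw [← R.range_levelPerm hK hdp n (h n)] at h1
    obtain ⟨g, hg⟩ := h1
    obtain ⟨g, rfl⟩ := AlgEquiv.restrictNormalHom_surjective (F := K)
      (K₁ := levelField (shiftedPower K p d) 0 n) (SeparableClosure K) g
    exact ⟨g, fun x => (levelPerm_restrictNormalHom n g x).symm.trans (Equiv.congr_fun hg x)⟩

end Ellis

end Arboreal

theorem mainTheorem3 (p d : ℕ) [Fact p.Prime] (hp : Odd p) (hd : d.Prime) (hd2 : Odd d)
    (hpd : p ≠ d) {K : Type*} [Field K] [Algebra ℚ_[p] K] [Algebra ℤ_[p] K]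
    [IsScalarTower ℤ_[p] ℚ_[p] K] [FiniteDimensional ℚ_[p] K]
    (m q : ℕ) (hK : Arboreal.IsUnramifiedOfDegree p K m) (hq : q = p ^ m)
    (f : K[X]) (hf : f = (X + C (p : K)) ^ d - C (p : K)) :
    (∀ n, Nat.card (Arboreal.Level f 0 n) = d ^ n) ∧
    ∃ c s : ℕ → ℕ,
      (∀ n, 0 < c n) ∧ Monotone s ∧ ¬ BddAbove (Set.range s) ∧
      (∀ n, s n = orderOf (q : ZMod (d ^ n))) ∧
      ∃ Φ : Arboreal.BS q →* Arboreal.TreeAut f 0,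
        (∀ n (x y : Arboreal.Level f 0 n), ∃ g, Arboreal.actLevel (Φ g) n x = y) ∧
        Arboreal.ellisSemigroup Φ = Arboreal.arborealImage f 0 ∧
        (∀ n, ∃ e : Arboreal.Metacyclic q (c n * d ^ n) (s n) ≃*
              (Arboreal.levelField f 0 n ≃ₐ[K] Arboreal.levelField f 0 n),
            ∀ (g : Arboreal.BS q) (x : Arboreal.Level f 0 n),
              e (Arboreal.BS.toMetacyclic q (c n * d ^ n) (s n) g) x.toLevelField =
                (Arboreal.actLevel (Φ g) n x).toLevelField) ∧
        (∀ n, (Arboreal.BS.toMetacyclic q (c n * d ^ n) (s n)).ker =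
            Subgroup.closure
              {Arboreal.BS.tau q ^ (c n * d ^ n), Arboreal.BS.sigma q ^ s n}) ∧
        ∃ (v : Arboreal.Path f 0) (S : Arboreal.GroupChain (Arboreal.BS q)),
          (∀ n, S.grp n = Arboreal.vertexStabilizer Φ (v.vertex n)) ∧
          (∀ n, S.grp n =
            Subgroup.closure {Arboreal.BS.tau q ^ (c n * d ^ n), Arboreal.BS.sigma q}) ∧
          (∀ n, S.core 0 n =
            Subgroup.closure
              {Arboreal.BS.tau q ^ (c n * d ^ n), Arboreal.BS.sigma q ^ s n}) ∧
          (∀ n, Arboreal.IsCantorGroup (S.Disc n)) ∧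
          (∀ (n k : ℕ) (h : n ≤ k), IsHomeomorph (S.discMap h)) ∧
          S.IsStable := by
  open Arboreal in
  obtain rfl : f = shiftedPower K p d := hf
  subst hq
  have hp' : p.Prime := Fact.out
  have : Fact d.Prime := ⟨hd⟩
  have : CharZero K := charZero_of_injective_algebraMap (algebraMap ℚ_[p] K).injective
  have hdp : d.Coprime p := (Nat.coprime_primes hd hp').2 hpd.symm
  have h : ∀ n, (p ^ m).Coprime (d ^ n) := fun n => (hdp.symm.pow_left m).pow_right n
  have hq1 : 1 < p ^ m := Nat.one_lt_pow hK.exists_isMaximal.1.ne' hp'.one_lt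
  have hd0 (n : ℕ) : NeZero (d ^ n) := ⟨pow_ne_zero _ hd.ne_zero⟩
  obtain ⟨R⟩ := nonempty_rootSystem (K := K) p hd
  refine ⟨R.card_level, fun _ => 1, fun n => orderOf ((p ^ m : ℕ) : ZMod (d ^ n)),
    fun _ => one_pos, monotone_orderOf_natCast hd.one_lt h, ?_, fun _ => rfl, R.treeAction h,
    fun n x y => ?_, R.ellisSemigroup_treeAction hK hdp h, fun n => ?_, fun n => ?_,
    R.basePath, affineChain hd.pos h, R.vertexStabilizer_treeAction hd.pos h, fun n => ?_,
    fun n => ?_, isCantorGroup_affineChain_disc hd.one_lt hq1 h,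
    fun n k hnk => isHomeomorph_affineChain_discMap hd.pos h hnk,
    0, fun n _ => (isHomeomorph_affineChain_discMap hd.pos h n.le_succ).bijective⟩
  · rintro ⟨b, hb⟩
    obtain ⟨n, hn⟩ := exists_lt_orderOf_natCast hd.one_lt hq1 h b
    exact (hb ⟨n, rfl⟩).not_gt hn
  · obtain ⟨i, rfl⟩ := (R.levelEquiv n).surjective x
    obtain ⟨j, rfl⟩ := (R.levelEquiv n).surjective y
    obtain ⟨g, hg⟩ := affineAction_transitive (h n) i j
    exact ⟨g, by rw [R.actLevel_treeAction, hg]⟩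
  · simp only
    rw [one_mul]
    exact R.exists_mulEquiv hK hdp h n
  · simp only
    rw [one_mul]
    exact ker_toMetacyclic (h n)
  · rw [one_mul]
    rfl
  · rw [one_mul]
    exact affineChain_core_zero hd.pos h n
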